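/- Let $\rho>0$ and $M=\mathbb S^1\times[-\rho,\rho]$ with $\mathbb S^1=\mathbb R/2\pi\mathbb Z$. Let $g_0=dr^2+f(r)^2\,d\theta^2$ be a Riemannian metric on $M$ of area $1$, where $f:[-\rho,\rho]\to(0,\infty)$ is smooth and even (so that $g_0$ is symmetric by reflection in the middle parallel $\mathbb S^1\times\{0\}$). Suppose that its scalar curvature satisfies $R_{g_0}\ge 0$, that the geodesic curvature of the boundary (with the sign for which the boundary of a flat disc has positive geodesic curvature) satisfies $k_{g_0}\le 0$ on $\partial M$, and that $R_{g_0}$ is decreasing from the middle, i.e. it is non-increasing along meridians as one moves from the middle parallel towards either boundary component. Let $g(t)$, $t\in[0,\infty)$, be a solution of the normalised Ricci flow on $M$ starting at $g_0$, that is, a family of Riemannian metrics on $M$, smooth on $M\times(0,\infty)$ up to the boundary of $M$, with $g$ and its scalar curvature $R$ continuous on $M\times[0,\infty)$, such that $$\frac{\partial g}{\partial t}=(r-R)\,g\ \text{ in } M\times(0,\infty),\qquad k_g=\frac{k_{g_0}}{\sqrt{\phi(t)}}\ \text{ on }\partial M\times(0,\infty),\qquad g(0)=g_0,$$ where $r(t)=\int_M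 R\,dA_{g(t)}$ and $\phi(t)=\exp\left(\int_0^t r(s)\,ds\right)$ is the factor by which $g=\phi\,\tilde g$ differs from the corresponding solution $\tilde g$ of the unnormalised flow $\partial\tilde g/\partial\tilde t=-\tilde R\tilde g$, $k_{\tilde g}=k_{g_0}$ on $\partial M$, $\tilde g(0)=g_0$ (with $dt=\phi\,d\tilde t$). Then $$\lim_{t\to\infty}\ \sup_{x\in M}|R(x,t)|=0 .$$ -/

import Mathlib

open Set Filter Topology
open scoped ContDiff

namespace Cylinder

/-- Points of the universal cover of the cylinder, in the coordinates `p 0 = θ`, `p 1 = r`. -/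
abbrev Pt : Type := Fin 2 → ℝ

/-- The strip `ℝ × [-ρ, ρ]`, universal cover of `M = 𝕊¹ × [-ρ, ρ]`, where `𝕊¹ = ℝ / 2πℤ`.
Functions and tensors on `M` are the objects on the strip that are `2π`-periodic in `θ`. -/
def band (ρ : ℝ) : Set Pt := {p | p 1 ∈ Icc (-ρ) ρ}

/-- The boundary `r = ±ρ`. -/
def bdry (ρ : ℝ) : Set Pt := {p | p 1 = -ρ ∨ p 1 = ρ}

/-- A field of `2 × 2` matrices: the components `g p i j` of a tensor of type `(0,2)` in the
coordinates `(θ, r)`. -/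
abbrev Field2 : Type := Pt → Matrix (Fin 2) (Fin 2) ℝ

/-- `g` is a Riemannian metric on `M`, smooth up to the boundary. -/
structure IsRiemannianMetric (ρ : ℝ) (g : Field2) : Prop where
  posDef : ∀ p ∈ band ρ, (g p).PosDef
  periodic : ∀ θ : ℝ, ∀ r ∈ Icc (-ρ) ρ, g ![θ + 2 * Real.pi, r] = g ![θ, r]
  smooth : ∀ i j, ContDiffOn ℝ ∞ (fun p => g p i j) (band ρ)

/-- The partial derivative `∂ᵢ u`, one-sided at the boundary. -/
noncomputable def pd (ρ : ℝ) (i : Fin 2) (u : Pt → ℝ) (p : Pt) : ℝ :=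
  fderivWithin ℝ u (band ρ) p (Pi.single i 1)

/-- The Christoffel symbol `Γᵏᵢⱼ` of the Levi-Civita connection of `g`. -/
noncomputable def christoffel (ρ : ℝ) (g : Field2) (k i j : Fin 2) (p : Pt) : ℝ :=
  (1 / 2) * ∑ l, (g p)⁻¹ k l *
    (pd ρ i (fun q => g q j l) p + pd ρ j (fun q => g q i l) p - pd ρ l (fun q => g q i j) p)

/-- The component `Rˡᵢⱼₖ` of the curvature tensor, `R(∂ᵢ, ∂ⱼ) ∂ₖ = ∑ₗ Rˡᵢⱼₖ ∂ₗ`. -/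
noncomputable def riemann (ρ : ℝ) (g : Field2) (l i j k : Fin 2) (p : Pt) : ℝ :=
  pd ρ i (christoffel ρ g l j k) p - pd ρ j (christoffel ρ g l i k) p
    + ∑ m, (christoffel ρ g l i m p * christoffel ρ g m j k p
        - christoffel ρ g l j m p * christoffel ρ g m i k p)

/-- The Ricci tensor `Ricⱼₖ = ∑ᵢ Rⁱᵢⱼₖ`. -/
noncomputable def ricci (ρ : ℝ) (g : Field2) (j k : Fin 2) (p : Pt) : ℝ :=
  ∑ i, riemann ρ g i i j k p

/-- The scalar curvature `R_g = ∑ gʲᵏ Ricⱼₖ` (twice the Gauss curvature). -/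
noncomputable def scalarCurv (ρ : ℝ) (g : Field2) (p : Pt) : ℝ :=
  ∑ j, ∑ k, (g p)⁻¹ j k * ricci ρ g j k p

/-- The outward unit normal `η` of `M` at a boundary point: `±∇r / |∇r|` at `r = ±ρ`. -/
noncomputable def outwardNormal (g : Field2) (p : Pt) (i : Fin 2) : ℝ :=
  Real.sign (p 1) * (g p)⁻¹ i 1 / √((g p)⁻¹ 1 1)

/-- The geodesic curvature `k_g = -⟨∇_T T, η⟩` of the boundary, `T = ∂_θ / |∂_θ|` the unit tangent;
the sign is the one for which the boundary of a flat disc has positive geodesic curvature.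
(The derivative of `1 / |∂_θ|` contributes only a tangential term to `∇_T T`.) -/
noncomputable def geodCurv (ρ : ℝ) (g : Field2) (p : Pt) : ℝ :=
  -(∑ k, ∑ l, g p k l * christoffel ρ g k 0 0 p * outwardNormal g p l) / g p 0 0

/-- The integral `∫_M u dA_g` over the cylinder. -/
noncomputable def integralM (ρ : ℝ) (g : Field2) (u : Pt → ℝ) : ℝ :=
  ∫ θ in (0 : ℝ)..(2 * Real.pi), ∫ r in (-ρ)..ρ, u ![θ, r] * √((g ![θ, r]).det)

/-- The area of `M`. -/
noncomputable def area (ρ : ℝ) (g : Field2) : ℝ := integralM ρ g (fun _ => 1)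

/-- `r = ∫_M R_g dA_g`, the average scalar curvature of a metric of area one. -/
noncomputable def avgCurv (ρ : ℝ) (g : Field2) : ℝ := integralM ρ g (scalarCurv ρ g)

/-- The factor `φ(t)` in `g = φ g̃` between the normalised flow `g` and the unnormalised flow `g̃`
(with `dt = φ dt̃`). Since `∂g/∂t = (r - R) g` and `∂g̃/∂t̃ = -R̃ g̃`, it is the solution of `φ' = r φ`,
and `φ(0) = 1` as both flows start at the same metric, of area one. -/
noncomputable def normFactor (ρ : ℝ) (g : ℝ → Field2) (t : ℝ) : ℝ :=
  Real.exp (∫ s in (0 : ℝ)..t, avgCurv ρ (g s))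

/-- `g(t)`, `0 ≤ t < ∞`, is a solution on the cylinder of the normalised Ricci flow
`∂g/∂t = (r - R) g` in `M`, `k_g = k_{g₀} / √φ` on `∂M`, `g(0) = g₀`.
It is smooth up to the boundary for `t > 0`; the metric and its scalar curvature are continuous
up to `t = 0`. -/
structure IsNormalisedRicciFlow (ρ : ℝ) (g₀ : Field2) (g : ℝ → Field2) : Prop where
  metric : ∀ t, 0 ≤ t → IsRiemannianMetric ρ (g t)
  smooth : ∀ i j, ContDiffOn ℝ ∞ (fun q : ℝ × Pt => g q.1 q.2 i j) (Ioi 0 ×ˢ band ρ)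
  continuous : ∀ i j, ContinuousOn (fun q : ℝ × Pt => g q.1 q.2 i j) (Ici 0 ×ˢ band ρ)
  continuous_scalarCurv :
    ContinuousOn (fun q : ℝ × Pt => scalarCurv ρ (g q.1) q.2) (Ici 0 ×ˢ band ρ)
  initial : ∀ p ∈ band ρ, g 0 p = g₀ p
  evolution : ∀ t, 0 < t → ∀ p ∈ band ρ, ∀ i j,
    HasDerivAt (fun s => g s p i j) ((avgCurv ρ (g t) - scalarCurv ρ (g t) p) * g t p i j) t
  boundary : ∀ t, 0 < t → ∀ p ∈ bdry ρ,
    geodCurv ρ (g t) p = geodCurv ρ g₀ p / √(normFactor ρ g t)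

/-- The rotationally symmetric metric `dr² + f(r)² dθ²`. -/
def rotMetric (f : ℝ → ℝ) : Field2 := fun p => !![f (p 1) ^ 2, 0; 0, 1]

/-- A function on `M` is decreasing from the middle: it does not increase along a meridian as one
moves from the middle parallel `r = 0` towards either boundary component. -/
def DecreasingFromMiddle (ρ : ℝ) (u : Pt → ℝ) : Prop :=
  ∀ θ : ℝ, ∀ r ∈ Icc (-ρ) ρ, ∀ s ∈ Icc (-ρ) ρ,
    (0 ≤ r ∧ r ≤ s ∨ s ≤ r ∧ r ≤ 0) → u ![θ, s] ≤ u ![θ, r]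

end Cylinder

/-! The flow is conformal, so `g = exp w * (dθ² + dr² / f²)` with `f` fixed. The difference of `w`
and a rotation of it obeys a maximum principle; at the boundary the sign `k_{g₀} ≤ 0` is what makes
it work. Hence `w` does not depend on `θ` (`logFactor_shift_le`). With `ds = dr / f`, what remains
is a problem on an interval for `W` and `R = -exp (-W) * W_ss`: `W_t = a - R`, where `a` is the
average curvature. Differentiating the boundary condition in time gives a dissipative Robin
condition for `R`.

The maximum principle keeps `R ≥ 0` (`R_nonneg`). Then `W_s` is monotone in space, and its boundary
values are bounded because `W - ∫ a`, the unnormalised log factor, only decreases. So `W` has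
bounded oscillation, and area one bounds it on both sides (`exists_exp_bounds`). By Gauss–Bonnet, `a
* exp (∫ a / 2)` is a boundary length weighted by `-k_{g₀}`, hence comparable to a constant. This is
a differential inequality for `exp (∫ a / 2)`, which gives `a = O(1/t)` (`exists_avg_le`).

Let `E` be the integral of `R²` against `exp W ds` and `D` that of `R_s²` against `ds`. Then `E' ≤
-2 D + ∫ R³`, and Cauchy–Schwarz gives `R² ≤ 2 a² + 2 J D` with `J = ∫ ds`. Once `a` is small the
cubic term is at most `D + a³` (`energy_cubic_le`), so `E' ≤ -D + O(t⁻³)`. As `E ≥ 0`, every late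
unit time interval contains a time at which `D`, and with it `sup R`, is small. A barrier carries
this smallness over the rest of the interval (`R_le_of_le`), which gives `exists_R_le`. -/

namespace Cylinder

/-! ### Maximum principles -/

/-- A positive derivative just to the right would make `u` strictly increasing there. Only a
one-sided neighbourhood enters, so `x` may be the left endpoint; the mirror statement below serves
the right endpoint. -/
theorem not_eventually_pos_right_of_max {a b x : ℝ} {u u' : ℝ → ℝ} (hx : x ∈ Icc a b)
    (hu : ∀ y ∈ Icc a b, HasDerivWithinAt u (u' y) (Icc a b) y)
    (hmax : ∀ y ∈ Icc a b, u y ≤ u x) (hxb : x < b) : ¬ ∀ᶠ y in 𝓝[>] x, 0 < u' y := by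
  intro h
  obtain ⟨z, hz, hsub⟩ := (mem_nhdsGT_iff_exists_Ioo_subset' hxb).1 h
  have hz' : x < min z b := lt_min hz hxb
  have hin : Icc x (min z b) ⊆ Icc a b := Icc_subset_Icc hx.1 (min_le_right _ _)
  have hmono : StrictMonoOn u (Icc x (min z b)) := by
    apply strictMonoOn_of_deriv_pos (convex_Icc _ _)
    · exact fun y hy => ((hu y (hin hy)).continuousWithinAt).mono hin
    · intro y hy
      rw [interior_Icc] at hy
      have hy' : Icc a b ∈ 𝓝 y :=
        Icc_mem_nhds (hx.1.trans_lt hy.1) (hy.2.trans_le (min_le_right _ _))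
      rw [((hu y (hin (Ioo_subset_Icc_self hy))).hasDerivAt hy').deriv]
      exact hsub ⟨hy.1, hy.2.trans_le (min_le_left _ _)⟩
  have := hmono (left_mem_Icc.2 hz'.le) (right_mem_Icc.2 hz'.le) hz'
  exact absurd (hmax _ (hin (right_mem_Icc.2 hz'.le))) (not_le.2 this)

theorem not_eventually_neg_left_of_max {a b x : ℝ} {u u' : ℝ → ℝ} (hx : x ∈ Icc a b)
    (hu : ∀ y ∈ Icc a b, HasDerivWithinAt u (u' y) (Icc a b) y)
    (hmax : ∀ y ∈ Icc a b, u y ≤ u x) (hax : a < x) : ¬ ∀ᶠ y in 𝓝[<] x, u' y < 0 := by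
  intro h
  obtain ⟨z, hz, hsub⟩ := (mem_nhdsLT_iff_exists_Ioo_subset' hax).1 h
  have hz' : max z a < x := max_lt hz hax
  have hin : Icc (max z a) x ⊆ Icc a b := Icc_subset_Icc (le_max_right _ _) hx.2
  have hanti : StrictAntiOn u (Icc (max z a) x) := by
    apply strictAntiOn_of_deriv_neg (convex_Icc _ _)
    · exact fun y hy => ((hu y (hin hy)).continuousWithinAt).mono hin
    · intro y hy
      rw [interior_Icc] at hy
      have hy' : Icc a b ∈ 𝓝 y :=
        Icc_mem_nhds ((le_max_right _ _).trans_lt hy.1) (hy.2.trans_le hx.2)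
      rw [((hu y (hin (Ioo_subset_Icc_self hy))).hasDerivAt hy').deriv]
      exact hsub ⟨(le_max_left _ _).trans_lt hy.1, hy.2⟩
  have := hanti (left_mem_Icc.2 hz'.le) (right_mem_Icc.2 hz'.le) hz'
  exact absurd (hmax _ (hin (left_mem_Icc.2 hz'.le))) (not_le.2 this)

/-- Second derivative test at a maximum on a closed interval, the endpoints included: there the
boundary condition makes the first derivative vanish. The derivative is `m * q`, with `m > 0`. -/
theorem deriv_flux_nonpos_of_max {a b x L : ℝ} {u q m : ℝ → ℝ} (hab : a < b)
    (hx : x ∈ Icc a b)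
    (hu : ∀ y ∈ Icc a b, HasDerivWithinAt u (m y * q y) (Icc a b) y)
    (hm : ∀ y ∈ Icc a b, 0 < m y) (hmax : ∀ y ∈ Icc a b, u y ≤ u x)
    (hb : x = b → q x ≤ 0) (ha : x = a → 0 ≤ q x)
    (hq : HasDerivWithinAt q L (Icc a b) x) : L ≤ 0 := by
  have hR : x < b → 𝓝[>] x ≤ 𝓝[Icc a b] x := fun h =>
    nhdsWithin_le_of_mem (mem_of_superset (Ioo_mem_nhdsGT h)
      fun y hy => ⟨hx.1.trans hy.1.le, hy.2.le⟩)
  have hL : a < x → 𝓝[<] x ≤ 𝓝[Icc a b] x := fun h =>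
    nhdsWithin_le_of_mem (mem_of_superset (Ioo_mem_nhdsLT h)
      fun y hy => ⟨hy.1.le, hy.2.le.trans hx.2⟩)
  have hmemR : x < b → ∀ᶠ y in 𝓝[>] x, y ∈ Icc a b := fun h => hR h self_mem_nhdsWithin
  have hmemL : a < x → ∀ᶠ y in 𝓝[<] x, y ∈ Icc a b := fun h => hL h self_mem_nhdsWithin
  -- At an endpoint one sign of `q x` is assumed and the other follows from maximality; in the
  -- interior both follow from maximality.
  have h1 : q x ≤ 0 := by
    rcases hx.2.eq_or_lt with h | h
    · exact hb h
    by_contra hpos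
    refine not_eventually_pos_right_of_max hx hu hmax h ?_
    filter_upwards [hmemR h, hR h (hq.continuousWithinAt (Ioi_mem_nhds (not_le.1 hpos)))]
      with y hy hy2
    exact mul_pos (hm y hy) hy2
  have h2 : 0 ≤ q x := by
    rcases hx.1.eq_or_lt with h | h
    · exact ha h.symm
    by_contra hneg
    refine not_eventually_neg_left_of_max hx hu hmax h ?_
    filter_upwards [hmemL h, hL h (hq.continuousWithinAt (Iio_mem_nhds (not_le.1 hneg)))]
      with y hy hy2
    exact mul_neg_of_pos_of_neg (hm y hy) hy2
  have h0 : q x = 0 := le_antisymm h1 h2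
  by_contra hLpos
  rw [not_le] at hLpos
  have hs := hasDerivWithinAt_iff_tendsto_slope.1 hq (Ioi_mem_nhds hLpos)
  have hs' : ∀ᶠ y in 𝓝[Icc a b] x, y ≠ x → 0 < slope q x y := by
    have := (mem_nhdsWithin_iff_eventually.1 (show {y | 0 < slope q x y} ∈ _ from hs))
    rw [eventually_nhdsWithin_iff]
    filter_upwards [this] with y hy h1 h2
    exact hy ⟨h1, h2⟩
  -- Since `q x = 0`, a positive slope gives `q` the sign of `y - x`, so `u` exceeds its maximum on
  -- either side. The right side is used unless `x = b`.
  rcases hx.2.eq_or_lt with h | h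
  · refine not_eventually_neg_left_of_max hx hu hmax (h ▸ hab) ?_
    have h' : a < x := h ▸ hab
    filter_upwards [hmemL h', hL h' hs', self_mem_nhdsWithin] with y hy hy2 hy3
    have := hy2 (ne_of_lt hy3)
    rw [slope_def_field, h0, sub_zero] at this
    refine mul_neg_of_pos_of_neg (hm y hy) ?_
    have h4 : y - x < 0 := sub_neg.2 hy3
    by_contra h5
    exact absurd this (not_lt.2 (div_nonpos_of_nonneg_of_nonpos (not_lt.1 h5) h4.le))
  · refine not_eventually_pos_right_of_max hx hu hmax h ?_
    filter_upwards [hmemR h, hR h hs', self_mem_nhdsWithin] with y hy hy2 hy3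
    have := hy2 (ne_of_gt hy3)
    rw [slope_def_field, h0, sub_zero] at this
    refine mul_pos (hm y hy) ?_
    have h4 : 0 < y - x := sub_pos.2 hy3
    by_contra h5
    exact absurd this (not_lt.2 (div_nonpos_of_nonpos_of_nonneg (not_lt.1 h5) h4.le))

/-- Parabolic maximum principle: a function that is `≤ 0` at the initial time stays so if at every
positive spatial maximum its time derivative is at most a multiple of its value. -/
theorem nonpos_of_deriv_le_at_max {X : Type*} [TopologicalSpace X] {K : Set X} (hK : IsCompact K)
    {t₀ T C : ℝ} {D : ℝ × X → ℝ} (hc : ContinuousOn D (Icc t₀ T ×ˢ K))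
    (h0 : ∀ x ∈ K, D (t₀, x) ≤ 0)
    (hd : ∀ t ∈ Ioc t₀ T, ∀ x ∈ K, (∀ y ∈ K, D (t, y) ≤ D (t, x)) → 0 < D (t, x) →
      ∃ d, HasDerivAt (fun s => D (s, x)) d t ∧ d ≤ C * D (t, x)) :
    ∀ t ∈ Icc t₀ T, ∀ x ∈ K, D (t, x) ≤ 0 := by
  intro t₁ ht₁ x₁ hx₁
  by_contra hpos
  rw [not_le] at hpos
  -- The weight with exponent `C + 1` turns the bound `d ≤ C * D` into a strictly negative time
  -- derivative at the space-time maximum.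
  obtain ⟨⟨t, x⟩, ⟨ht, hx⟩, hmax⟩ := (isCompact_Icc.prod hK).exists_isMaxOn
    ⟨(t₁, x₁), ht₁, hx₁⟩
    (f := fun q : ℝ × X => Real.exp (-(C + 1) * q.1) * D q) (by
      refine ContinuousOn.mul ?_ hc
      fun_prop)
  simp only at ht hx
  have hm1 : Real.exp (-(C + 1) * t₁) * D (t₁, x₁) ≤ Real.exp (-(C + 1) * t) * D (t, x) :=
    hmax (show (t₁, x₁) ∈ Icc t₀ T ×ˢ K from ⟨ht₁, hx₁⟩)
  have hDpos : 0 < D (t, x) :=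
    pos_of_mul_pos_right ((mul_pos (Real.exp_pos _) hpos).trans_le hm1) (Real.exp_pos _).le
  have htt : t₀ < t := by
    rcases ht.1.eq_or_lt with h | h
    · exact absurd (h0 x hx) (by rw [h]; exact not_le.2 hDpos)
    · exact h
  obtain ⟨d, hd1, hd2⟩ := hd t ⟨htt, ht.2⟩ x hx (fun y hy => by
    have : Real.exp (-(C + 1) * t) * D (t, y) ≤ Real.exp (-(C + 1) * t) * D (t, x) :=
      hmax (show (t, y) ∈ Icc t₀ T ×ˢ K from ⟨ht, hy⟩)
    exact le_of_mul_le_mul_left this (Real.exp_pos _)) hDpos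
  have hder : HasDerivAt (fun s => Real.exp (-(C + 1) * s) * D (s, x))
      (Real.exp (-(C + 1) * t) * (d - (C + 1) * D (t, x))) t := by
    have h1 : HasDerivAt (fun s => Real.exp (-(C + 1) * s))
        (Real.exp (-(C + 1) * t) * (-(C + 1) * 1)) t :=
      ((hasDerivAt_id t).const_mul (-(C + 1))).exp
    refine (h1.mul hd1).congr_deriv ?_
    ring
  have hneg : Real.exp (-(C + 1) * t) * (d - (C + 1) * D (t, x)) < 0 :=
    mul_neg_of_pos_of_neg (Real.exp_pos _) (by linarith)
  have hs := (hasDerivAt_iff_tendsto_slope.1 hder).eventually (Iio_mem_nhds hneg)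
  have hs' : ∀ᶠ s in 𝓝[<] t, slope (fun s => Real.exp (-(C + 1) * s) * D (s, x)) t s < 0 :=
    (nhdsWithin_mono t (fun s (hs : s ∈ Iio t) => ne_of_lt hs)) hs
  -- Only earlier times are compared, so the final time `T` is no exception.
  obtain ⟨s, hs1, hs2⟩ := (hs'.and (Ioo_mem_nhdsLT htt)).exists
  have hle : Real.exp (-(C + 1) * s) * D (s, x) ≤ Real.exp (-(C + 1) * t) * D (t, x) :=
    hmax (show (s, x) ∈ Icc t₀ T ×ˢ K from ⟨⟨hs2.1.le, hs2.2.le.trans ht.2⟩, hx⟩)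
  rw [slope_def_field] at hs1
  exact absurd hs1 (not_lt.2 (div_nonneg_of_nonpos (sub_nonpos.2 hle) (sub_nonpos.2 hs2.2.le)))

/-! ### Directional derivatives on sets with boundary -/

section DirDeriv

variable {E : Type*} [NormedAddCommGroup E] [NormedSpace ℝ E]

/-- The derivative of `u` within `S` in the direction `v`. -/
noncomputable def dirDeriv (S : Set E) (v : E) (u : E → ℝ) (q : E) : ℝ := fderivWithin ℝ u S q v

theorem contDiffOn_dirDeriv {S : Set E} (hS : UniqueDiffOn ℝ S) (v : E) {u : E → ℝ}
    (hu : ContDiffOn ℝ ∞ u S) : ContDiffOn ℝ ∞ (dirDeriv S v u) S :=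
  (hu.fderivWithin hS (m := ∞) (by simp)).clm_apply contDiffOn_const

theorem dirDeriv_congr {S : Set E} {v : E} {u w : E → ℝ} (h : EqOn u w S) {q : E} (hq : q ∈ S) :
    dirDeriv S v u q = dirDeriv S v w q := by
  rw [dirDeriv, dirDeriv, fderivWithin_congr h (h hq)]

/-- Derivative along a curve of constant velocity inside `S`. -/
theorem hasDerivWithinAt_line {S : Set E} {u : E → ℝ} (hu : ContDiffOn ℝ ∞ u S) {v : E}
    {γ : ℝ → E} {J : Set ℝ} {s : ℝ} (hγ : HasDerivWithinAt γ v J s) (hmaps : MapsTo γ J S)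
    (hs : s ∈ J) : HasDerivWithinAt (fun x => u (γ x)) (dirDeriv S v u (γ s)) J s :=
  ((hu.differentiableOn (by simp) _ (hmaps hs)).hasFDerivWithinAt).comp_hasDerivWithinAt s hγ hmaps

/-- The hypothesis `hcl` carries the symmetry of the second derivative from interior points to the
boundary. -/
theorem dirDeriv_comm {S : Set E} (hS : UniqueDiffOn ℝ S) (hcl : S ⊆ closure (interior S))
    (v w : E) {u : E → ℝ} (hu : ContDiffOn ℝ ∞ u S) {q : E} (hq : q ∈ S) :
    dirDeriv S v (dirDeriv S w u) q = dirDeriv S w (dirDeriv S v u) q := by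
  have hd : DifferentiableWithinAt ℝ (fderivWithin ℝ u S) S q :=
    (hu.fderivWithin hS (m := ∞) (by simp)).differentiableOn (by simp) q hq
  have key : ∀ a b : E, dirDeriv S a (dirDeriv S b u) q
      = fderivWithin ℝ (fderivWithin ℝ u S) S q a b := by
    intro a b
    have := (hd.hasFDerivWithinAt.clm_apply (hasFDerivWithinAt_const b q S)).fderivWithin (hS q hq)
    change fderivWithin ℝ (fun y => fderivWithin ℝ u S y b) S q a = _
    rw [this]
    simp
  rw [key, key]
  exact (hu q hq).isSymmSndFDerivWithinAt
    (by simpa using (by exact_mod_cast le_top : ((2 : ℕ∞) : WithTop ℕ∞) ≤ ∞)) hS (hcl hq) hq v w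

end DirDeriv

/-! ### The strip `(0, ∞) × [-ρ, ρ]` -/

/-- The space-time strip. -/
abbrev strip (ρ : ℝ) : Set (ℝ × ℝ) := Ioi 0 ×ˢ Icc (-ρ) ρ

theorem uniqueDiffOn_strip {ρ : ℝ} (hρ : 0 < ρ) : UniqueDiffOn ℝ (strip ρ) :=
  (uniqueDiffOn_Ioi 0).prod (uniqueDiffOn_Icc (by linarith))

theorem strip_subset_closure {ρ : ℝ} (hρ : 0 < ρ) : strip ρ ⊆ closure (interior (strip ρ)) := by
  rw [interior_prod_eq, closure_prod_eq, interior_Icc, interior_Ioi, closure_Ioo (by linarith)]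
  exact prod_mono subset_closure subset_rfl

/-- Time derivative. -/
noncomputable abbrev dt (ρ : ℝ) (u : ℝ × ℝ → ℝ) : ℝ × ℝ → ℝ := dirDeriv (strip ρ) (1, 0) u

/-- Spatial derivative. -/
noncomputable abbrev dx (ρ : ℝ) (u : ℝ × ℝ → ℝ) : ℝ × ℝ → ℝ := dirDeriv (strip ρ) (0, 1) u

theorem hasDerivAt_dt {ρ : ℝ} {u : ℝ × ℝ → ℝ} (hu : ContDiffOn ℝ ∞ u (strip ρ)) {t x : ℝ}
    (ht : 0 < t) (hx : x ∈ Icc (-ρ) ρ) :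
    HasDerivAt (fun s => u (s, x)) (dt ρ u (t, x)) t := by
  refine (hasDerivWithinAt_line hu (v := ((1 : ℝ), (0 : ℝ))) (γ := fun s => (s, x)) (J := Ioi 0)
    ?_ (fun s hs => ⟨hs, hx⟩) ht).hasDerivAt (Ioi_mem_nhds ht)
  exact ((hasDerivAt_id t).prodMk (hasDerivAt_const t x)).hasDerivWithinAt

theorem hasDerivWithinAt_dx {ρ : ℝ} {u : ℝ × ℝ → ℝ} (hu : ContDiffOn ℝ ∞ u (strip ρ)) {t x : ℝ}
    (ht : 0 < t) (hx : x ∈ Icc (-ρ) ρ) :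
    HasDerivWithinAt (fun y => u (t, y)) (dx ρ u (t, x)) (Icc (-ρ) ρ) x := by
  refine hasDerivWithinAt_line hu (v := ((0 : ℝ), (1 : ℝ))) (γ := fun y => (t, y))
    ?_ (fun y hy => ⟨ht, hy⟩) hx
  exact ((hasDerivAt_const x t).prodMk (hasDerivAt_id x)).hasDerivWithinAt

theorem continuousOn_slice {ρ t : ℝ} {u : ℝ × ℝ → ℝ} {J : Set ℝ}
    (hu : ContinuousOn u (J ×ˢ Icc (-ρ) ρ)) (ht : t ∈ J) :
    ContinuousOn (fun x => u (t, x)) (Icc (-ρ) ρ) :=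
  hu.comp (by fun_prop) fun _ hx => ⟨ht, hx⟩

theorem intervalIntegrable_slice {ρ t : ℝ} (hρ : 0 < ρ) {u : ℝ × ℝ → ℝ} {J : Set ℝ}
    (hu : ContinuousOn u (J ×ˢ Icc (-ρ) ρ)) (ht : t ∈ J) :
    IntervalIntegrable (fun x => u (t, x)) MeasureTheory.volume (-ρ) ρ := by
  apply ContinuousOn.intervalIntegrable
  rw [uIcc_of_le (by linarith)]
  exact continuousOn_slice hu ht

/-- Differentiation under the integral sign. -/
theorem hasDerivAt_integral_dt {ρ : ℝ} (hρ : 0 < ρ) {u : ℝ × ℝ → ℝ}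
    (hu : ContDiffOn ℝ ∞ u (strip ρ)) {t : ℝ} (ht : 0 < t) :
    HasDerivAt (fun s => ∫ x in (-ρ)..ρ, u (s, x)) (∫ x in (-ρ)..ρ, dt ρ u (t, x)) t := by
  have hle : -ρ ≤ ρ := by linarith
  have hc := (contDiffOn_dirDeriv (uniqueDiffOn_strip hρ) (1, 0) hu).continuousOn
  have hK : IsCompact (Icc (t / 2) (2 * t) ×ˢ Icc (-ρ) ρ) := isCompact_Icc.prod isCompact_Icc
  have hsub : Icc (t / 2) (2 * t) ×ˢ Icc (-ρ) ρ ⊆ strip ρ :=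
    prod_mono (fun s hs => lt_of_lt_of_le (by positivity) hs.1) subset_rfl
  obtain ⟨B, hB⟩ := hK.exists_bound_of_continuousOn (hc.mono hsub)
  refine (intervalIntegral.hasDerivAt_integral_of_dominated_loc_of_deriv_le
    (F := fun s x => u (s, x)) (F' := fun s x => dt ρ u (s, x)) (bound := fun _ => B)
    (s := Icc (t / 2) (2 * t)) (Icc_mem_nhds (by linarith) (by linarith)) ?_ ?_ ?_ ?_ ?_ ?_).2
  · filter_upwards [Ioi_mem_nhds ht] with s hs
    exact (intervalIntegrable_slice hρ hu.continuousOn hs).def'.aestronglyMeasurable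
  · exact intervalIntegrable_slice hρ hu.continuousOn ht
  · exact (intervalIntegrable_slice hρ hc ht).def'.aestronglyMeasurable
  · refine Eventually.of_forall fun x hx s hs => hB (s, x) ⟨hs, ?_⟩
    rw [uIoc_of_le hle] at hx
    exact Ioc_subset_Icc_self hx
  · exact intervalIntegrable_const
  · refine Eventually.of_forall fun x hx s hs => ?_
    rw [uIoc_of_le hle] at hx
    exact hasDerivAt_dt hu (hsub (mk_mem_prod hs (Ioc_subset_Icc_self hx))).1
      (Ioc_subset_Icc_self hx)

/-- The integral over the spatial variable is continuous in time. -/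
theorem continuousOn_integral_slice {ρ : ℝ} (hρ : 0 < ρ) {u : ℝ × ℝ → ℝ}
    (hu : ContinuousOn u (Ici 0 ×ˢ Icc (-ρ) ρ)) :
    ContinuousOn (fun s => ∫ x in (-ρ)..ρ, u (s, x)) (Ici 0) := by
  have hle : -ρ ≤ ρ := by linarith
  -- Clamping both variables extends the integrand to a continuous function on the whole plane.
  have h1 : Continuous fun q : ℝ × ℝ => u (max q.1 0, projIcc (-ρ) ρ hle q.2) := by
    refine hu.comp_continuous (by fun_prop) fun q => ⟨mem_Ici.2 (le_max_right _ _), ?_⟩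
    exact (projIcc (-ρ) ρ hle q.2).2
  have h2 := intervalIntegral.continuous_parametric_intervalIntegral_of_continuous'
    (μ := MeasureTheory.volume) (f := fun s x => u (max s 0, projIcc (-ρ) ρ hle x)) h1 (-ρ) ρ
  refine h2.continuousOn.congr fun s hs => ?_
  refine intervalIntegral.integral_congr fun x hx => ?_
  rw [uIcc_of_le hle] at hx
  simp only [max_eq_left (show (0 : ℝ) ≤ s from hs), projIcc_of_mem hle hx]

/-! ### Integral inequalities on an interval -/

/-- Fundamental theorem of calculus on `[a, b]` for derivatives within a larger interval. -/
theorem integral_eq_sub_of_hasDerivWithinAt {a b c d : ℝ} {u u' : ℝ → ℝ} (hab : a ≤ b)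
    (hsub : Icc a b ⊆ Icc c d) (hu : ∀ x ∈ Icc c d, HasDerivWithinAt u (u' x) (Icc c d) x)
    (hc : ContinuousOn u' (Icc c d)) : ∫ x in a..b, u' x = u b - u a := by
  refine intervalIntegral.integral_eq_sub_of_hasDerivAt_of_le hab
    (fun x hx => (hu x (hsub hx)).continuousWithinAt.mono hsub) (fun x hx => ?_) ?_
  · refine (hu x (hsub (Ioo_subset_Icc_self hx))).hasDerivAt (Icc_mem_nhds ?_ ?_)
    · exact (hsub (left_mem_Icc.2 hab)).1.trans_lt hx.1
    · exact hx.2.trans_le (hsub (right_mem_Icc.2 hab)).2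
  · apply ContinuousOn.intervalIntegrable
    rw [uIcc_of_le hab]
    exact hc.mono hsub

/-- A function attains values on both sides of its weighted average. -/
theorem exists_le_of_weighted_average {a b v : ℝ} {h m : ℝ → ℝ} (hab : a < b)
    (hh : ContinuousOn h (Icc a b)) (hm : ContinuousOn m (Icc a b))
    (hpos : ∀ x ∈ Icc a b, 0 < m x)
    (hint : ∫ x in a..b, m x * h x = v * ∫ x in a..b, m x) : ∃ x ∈ Icc a b, h x ≤ v := by
  by_contra! hcon
  have hi : ∀ {k : ℝ → ℝ}, ContinuousOn k (Icc a b) →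
      IntervalIntegrable k MeasureTheory.volume a b := fun hk => by
    apply ContinuousOn.intervalIntegrable
    rwa [uIcc_of_le hab.le]
  have h1 : 0 < ∫ x in a..b, (m x * h x - v * m x) := by
    refine intervalIntegral.intervalIntegral_pos_of_pos_on (hi (by fun_prop)) (fun x hx => ?_) hab
    have hx' := Ioo_subset_Icc_self hx
    nlinarith [hpos x hx', hcon x hx']
  rw [intervalIntegral.integral_sub (hi (by fun_prop)) (hi (by fun_prop)),
    intervalIntegral.integral_const_mul, hint, sub_self] at h1
  exact lt_irrefl _ h1

/-- The Cauchy–Schwarz estimate for the oscillation. -/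
theorem sq_sub_le_integral_mul {a b x y : ℝ} {u p f : ℝ → ℝ} (hx : x ∈ Icc a b) (hy : y ∈ Icc a b)
    (hf : ∀ z ∈ Icc a b, 0 < f z) (hfc : ContinuousOn f (Icc a b))
    (hu : ∀ z ∈ Icc a b, HasDerivWithinAt u (p z) (Icc a b) z) (hp : ContinuousOn p (Icc a b)) :
    (u x - u y) ^ 2 ≤ (∫ z in a..b, 1 / f z) * ∫ z in a..b, f z * p z ^ 2 := by
  wlog hyx : y < x generalizing x y
  · rcases (not_lt.1 hyx).eq_or_lt with h | h
    · rw [h, sub_self, zero_pow two_ne_zero]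
      have hab := hx.1.trans hx.2
      refine mul_nonneg (intervalIntegral.integral_nonneg hab fun z hz => ?_)
        (intervalIntegral.integral_nonneg hab fun z hz => ?_)
      · exact (one_div_pos.2 (hf z hz)).le
      · exact mul_nonneg (hf z hz).le (sq_nonneg _)
    · rw [← neg_sub, neg_sq]
      exact this hy hx h
  have hsub : Icc y x ⊆ Icc a b := Icc_subset_Icc hy.1 hx.2
  have hab := hx.1.trans hx.2
  have hne : ∀ z ∈ Icc a b, f z ≠ 0 := fun z hz => (hf z hz).ne'
  have c1 : ContinuousOn (fun z => 1 / f z) (Icc a b) := continuousOn_const.div hfc hne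
  have c2 : ContinuousOn (fun z => f z * p z ^ 2) (Icc a b) := hfc.mul (hp.pow 2)
  have hi : ∀ {k : ℝ → ℝ}, ContinuousOn k (Icc a b) →
      IntervalIntegrable k MeasureTheory.volume y x := fun hk => by
    apply ContinuousOn.intervalIntegrable
    rw [uIcc_of_le hyx.le]
    exact hk.mono hsub
  have hi' : ∀ {k : ℝ → ℝ}, ContinuousOn k (Icc a b) →
      IntervalIntegrable k MeasureTheory.volume a b := fun hk => by
    apply ContinuousOn.intervalIntegrable
    rwa [uIcc_of_le hab]
  set δ := u x - u y with hδ
  have hftc : ∫ z in y..x, p z = δ := integral_eq_sub_of_hasDerivWithinAt hyx.le hsub hu hp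
  set J := ∫ z in y..x, 1 / f z
  set D := ∫ z in y..x, f z * p z ^ 2
  have hJ : 0 < J := intervalIntegral.intervalIntegral_pos_of_pos_on (hi c1)
    (fun z hz => one_div_pos.2 (hf z (hsub (Ioo_subset_Icc_self hz)))) hyx
  have hD : 0 ≤ D := intervalIntegral.integral_nonneg hyx.le fun z hz =>
    mul_nonneg (hf z (hsub hz)).le (sq_nonneg _)
  -- The quadratic is the integral of `(f p - κ)² / f`; its minimum, at `κ = δ / J`, is the
  -- Cauchy–Schwarz inequality.
  have hquad : ∀ κ : ℝ, 0 ≤ D - 2 * κ * δ + κ ^ 2 * J := by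
    intro κ
    have h1 : D - 2 * κ * δ + κ ^ 2 * J
        = ∫ z in y..x, (f z * p z ^ 2 - 2 * κ * p z + κ ^ 2 * (1 / f z)) := by
      rw [intervalIntegral.integral_add ((hi c2).sub ((hi hp).const_mul _))
        ((hi c1).const_mul _), intervalIntegral.integral_sub (hi c2) ((hi hp).const_mul _),
        intervalIntegral.integral_const_mul, intervalIntegral.integral_const_mul, hftc]
    rw [h1]
    refine intervalIntegral.integral_nonneg hyx.le fun z hz => ?_
    have hz := hf z (hsub hz)
    have : f z * p z ^ 2 - 2 * κ * p z + κ ^ 2 * (1 / f z) = (f z * p z - κ) ^ 2 / f z := by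
      field_simp
      ring
    rw [this]
    positivity
  have h2 : δ ^ 2 ≤ J * D := by
    have := hquad (δ / J)
    have e : D - 2 * (δ / J) * δ + (δ / J) ^ 2 * J = D - δ ^ 2 / J := by
      field_simp
      ring
    rw [e, sub_nonneg, div_le_iff₀ hJ] at this
    linarith
  refine h2.trans (mul_le_mul ?_ ?_ hD ?_)
  · refine intervalIntegral.integral_mono_interval hy.1 hyx.le hx.2 ?_ (hi' c1)
    filter_upwards [MeasureTheory.ae_restrict_mem measurableSet_Ioc] with z hz
    exact (one_div_pos.2 (hf z (Ioc_subset_Icc_self hz))).le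
  · refine intervalIntegral.integral_mono_interval hy.1 hyx.le hx.2 ?_ (hi' c2)
    filter_upwards [MeasureTheory.ae_restrict_mem measurableSet_Ioc] with z hz
    exact mul_nonneg (hf z (Ioc_subset_Icc_self hz)).le (sq_nonneg _)
  · exact intervalIntegral.integral_nonneg hab fun z hz => (one_div_pos.2 (hf z hz)).le

end Cylinder

/-! ### The radial flow: evolution equations and preserved curvature bounds -/

namespace Cylinder

theorem eq_of_hasDerivAt_zero {u : ℝ → ℝ} (hc : ContinuousOn u (Ici 0))
    (hd : ∀ t, 0 < t → HasDerivAt u 0 t) {t : ℝ} (ht : 0 ≤ t) : u t = u 0 := by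
  rcases ht.eq_or_lt with h | h
  · rw [← h]
  obtain ⟨s, hs, hs'⟩ := exists_hasDerivAt_eq_slope u (fun _ => 0) h
    (hc.mono Icc_subset_Ici_self) (fun s hs => hd s hs.1)
  rw [eq_comm, div_eq_zero_iff] at hs'
  rcases hs' with h' | h' <;> linarith

/-- The rotationally symmetric normalised Ricci flow on the cylinder, in terms of
`W = log (lam * f ^ 2)` for the metric `lam * (dr² + f² dθ²)`, its scalar curvature `R` and the
average scalar curvature `a`. -/
structure CylFlow (ρ c₁ c₂ : ℝ) (f : ℝ → ℝ) (W R : ℝ × ℝ → ℝ) (a : ℝ → ℝ) : Prop where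
  hρ : 0 < ρ
  hc₁ : 0 ≤ c₁
  hc₂ : 0 ≤ c₂
  f_smooth : ContDiffOn ℝ ∞ f (Icc (-ρ) ρ)
  f_pos : ∀ x ∈ Icc (-ρ) ρ, 0 < f x
  W_smooth : ContDiffOn ℝ ∞ W (strip ρ)
  W_cont : ContinuousOn W (Ici 0 ×ˢ Icc (-ρ) ρ)
  R_cont : ContinuousOn R (Ici 0 ×ˢ Icc (-ρ) ρ)
  R_eq : ∀ q ∈ strip ρ, R q = -(f q.2 / Real.exp (W q)) * dx ρ (fun p => f p.2 * dx ρ W p) q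
  W_deriv : ∀ t, 0 < t → ∀ x ∈ Icc (-ρ) ρ, HasDerivAt (fun s => W (s, x)) (a t - R (t, x)) t
  avg : ∀ t, 0 ≤ t →
    a t = 2 * Real.pi * ∫ x in (-ρ)..ρ, Real.exp (W (t, x)) / f x * R (t, x)
  area_zero : 2 * Real.pi * ∫ x in (-ρ)..ρ, Real.exp (W (0, x)) / f x = 1
  R_zero : ∀ x ∈ Icc (-ρ) ρ, 0 ≤ R (0, x)
  -- The prescribed geodesic curvature is `-c / √φ`, and the conformal formula equates it with half
  -- the outward flux of `W` divided by `exp (W / 2)`.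
  bdry_right : ∀ t, 0 < t →
    f ρ * dx ρ W (t, ρ) = -2 * c₁ * Real.exp ((W (t, ρ) - ∫ s in (0 : ℝ)..t, a s) / 2)
  bdry_left : ∀ t, 0 < t →
    f (-ρ) * dx ρ W (t, -ρ) = 2 * c₂ * Real.exp ((W (t, -ρ) - ∫ s in (0 : ℝ)..t, a s) / 2)

namespace CylFlow

variable {ρ c₁ c₂ : ℝ} {f : ℝ → ℝ} {W R : ℝ × ℝ → ℝ} {a : ℝ → ℝ}

theorem right_mem (h : CylFlow ρ c₁ c₂ f W R a) : ρ ∈ Icc (-ρ) ρ :=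
  right_mem_Icc.2 (by linarith [h.hρ])

theorem left_mem (h : CylFlow ρ c₁ c₂ f W R a) : -ρ ∈ Icc (-ρ) ρ :=
  left_mem_Icc.2 (by linarith [h.hρ])

theorem f_smooth' (h : CylFlow ρ c₁ c₂ f W R a) :
    ContDiffOn ℝ ∞ (fun q : ℝ × ℝ => f q.2) (strip ρ) :=
  h.f_smooth.comp contDiff_snd.contDiffOn fun _ hq => hq.2

theorem flux_smooth (h : CylFlow ρ c₁ c₂ f W R a) {u : ℝ × ℝ → ℝ}
    (hu : ContDiffOn ℝ ∞ u (strip ρ)) :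
    ContDiffOn ℝ ∞ (fun p => f p.2 * dx ρ u p) (strip ρ) :=
  h.f_smooth'.mul (contDiffOn_dirDeriv (uniqueDiffOn_strip h.hρ) _ hu)

theorem R_smooth (h : CylFlow ρ c₁ c₂ f W R a) : ContDiffOn ℝ ∞ R (strip ρ) := by
  have h1 := contDiffOn_dirDeriv (uniqueDiffOn_strip h.hρ) (0, 1) (h.flux_smooth h.W_smooth)
  exact (((h.f_smooth'.div h.W_smooth.exp fun q _ => (Real.exp_pos _).ne').neg).mul h1).congr h.R_eq

theorem density_pos (h : CylFlow ρ c₁ c₂ f W R a) (t : ℝ) {x : ℝ} (hx : x ∈ Icc (-ρ) ρ) :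
    0 < Real.exp (W (t, x)) / f x := div_pos (Real.exp_pos _) (h.f_pos x hx)

theorem density_smooth (h : CylFlow ρ c₁ c₂ f W R a) :
    ContDiffOn ℝ ∞ (fun q => Real.exp (W q) / f q.2) (strip ρ) :=
  h.W_smooth.exp.div h.f_smooth' fun q hq => (h.f_pos q.2 hq.2).ne'

theorem density_cont (h : CylFlow ρ c₁ c₂ f W R a) :
    ContinuousOn (fun q => Real.exp (W q) / f q.2) (Ici 0 ×ˢ Icc (-ρ) ρ) :=
  (Real.continuous_exp.comp_continuousOn h.W_cont).div
    (h.f_smooth.continuousOn.comp continuousOn_snd fun _ hq => hq.2)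
    fun q hq => (h.f_pos q.2 hq.2).ne'

theorem avg_cont (h : CylFlow ρ c₁ c₂ f W R a) : ContinuousOn a (Ici 0) := by
  refine ContinuousOn.congr ?_ h.avg
  exact continuousOn_const.mul (continuousOn_integral_slice h.hρ (h.density_cont.mul h.R_cont))

theorem hasDerivAt_intAvg (h : CylFlow ρ c₁ c₂ f W R a) {t : ℝ} (ht : 0 < t) :
    HasDerivAt (fun t => ∫ s in (0 : ℝ)..t, a s) (a t) t := by
  have hI : IntervalIntegrable a MeasureTheory.volume 0 t := by
    apply ContinuousOn.intervalIntegrable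
    rw [uIcc_of_le ht.le]
    exact h.avg_cont.mono Icc_subset_Ici_self
  have hO : ContinuousOn a (Ioi 0) := h.avg_cont.mono Ioi_subset_Ici_self
  exact intervalIntegral.integral_hasDerivAt_right hI
    (hO.stronglyMeasurableAtFilter isOpen_Ioi t ht) (hO.continuousAt (Ioi_mem_nhds ht))

theorem intAvg_cont (h : CylFlow ρ c₁ c₂ f W R a) :
    ContinuousOn (fun t => ∫ s in (0 : ℝ)..t, a s) (Ici 0) := by
  intro t ht
  have hI : IntervalIntegrable a MeasureTheory.volume 0 (t + 1) := by
    apply ContinuousOn.intervalIntegrable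
    rw [uIcc_of_le (by linarith [mem_Ici.1 ht])]
    exact h.avg_cont.mono Icc_subset_Ici_self
  have h1 := intervalIntegral.continuousOn_primitive_interval (μ := MeasureTheory.volume) (f := a)
    (a := 0) (b := t + 1) ((intervalIntegrable_iff' (by finiteness)).1 hI)
  rw [uIcc_of_le (by linarith [mem_Ici.1 ht])] at h1
  refine (h1 t ⟨ht, by linarith⟩).mono_of_mem_nhdsWithin ?_
  filter_upwards [self_mem_nhdsWithin, mem_nhdsWithin_of_mem_nhds (Iio_mem_nhds (lt_add_one t))]
    with s hs hs'
  exact ⟨hs, le_of_lt hs'⟩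

theorem dt_W (h : CylFlow ρ c₁ c₂ f W R a) {t x : ℝ} (ht : 0 < t) (hx : x ∈ Icc (-ρ) ρ) :
    dt ρ W (t, x) = a t - R (t, x) :=
  (hasDerivAt_dt h.W_smooth ht hx).unique (h.W_deriv t ht x hx)

theorem unique_dx {ρ : ℝ} (hρ : 0 < ρ) {u : ℝ × ℝ → ℝ} (hu : ContDiffOn ℝ ∞ u (strip ρ)) {t x d : ℝ}
    (ht : 0 < t) (hx : x ∈ Icc (-ρ) ρ)
    (hd : HasDerivWithinAt (fun y => u (t, y)) d (Icc (-ρ) ρ) x) : dx ρ u (t, x) = d :=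
  (uniqueDiffOn_Icc (by linarith) x hx).eq_deriv _ (hasDerivWithinAt_dx hu ht hx) hd

/-- The two derivatives commute, and `a` drops out of `∂ₓ (a - R)` because it depends on time only.
-/
theorem dt_flux_W (h : CylFlow ρ c₁ c₂ f W R a) {t x : ℝ} (ht : 0 < t) (hx : x ∈ Icc (-ρ) ρ) :
    dt ρ (fun p => f p.2 * dx ρ W p) (t, x) = -(f x * dx ρ R (t, x)) := by
  have hU := uniqueDiffOn_strip h.hρ
  have h1 := hasDerivAt_dt (contDiffOn_dirDeriv hU (0, 1) h.W_smooth) ht hx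
  have h2 := (hasDerivAt_dt (h.flux_smooth h.W_smooth) ht hx).unique (h1.const_mul (f x))
  rw [h2]
  have h3 := dirDeriv_comm hU (strip_subset_closure h.hρ) (1, 0) (0, 1) h.W_smooth
    (q := (t, x)) ⟨ht, hx⟩
  change f x * dirDeriv _ (1, 0) (dirDeriv _ (0, 1) W) (t, x) = _
  rw [h3]
  have h4 : dx ρ (dt ρ W) (t, x) = -dx ρ R (t, x) := by
    refine unique_dx h.hρ (contDiffOn_dirDeriv hU (1, 0) h.W_smooth) ht hx ?_
    refine ((hasDerivWithinAt_dx h.R_smooth ht hx).const_sub (a t)).congr (fun y hy => ?_) ?_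
    · exact h.dt_W ht hy
    · exact h.dt_W ht hx
  change f x * dx ρ (dt ρ W) (t, x) = _
  rw [h4]
  ring

/-- The evolution equation of the curvature density. -/
theorem dt_mass (h : CylFlow ρ c₁ c₂ f W R a) {t x : ℝ} (ht : 0 < t) (hx : x ∈ Icc (-ρ) ρ) :
    dt ρ (fun q => Real.exp (W q) / f q.2 * R q) (t, x)
      = dx ρ (fun p => f p.2 * dx ρ R p) (t, x) := by
  have hU := uniqueDiffOn_strip h.hρ
  have hP := h.flux_smooth h.W_smooth
  -- The curvature density is a pure spatial derivative of the flux of `W`, so only the order of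
  -- differentiation has to be exchanged.
  have h1 : EqOn (fun q => Real.exp (W q) / f q.2 * R q)
      (fun q => -dx ρ (fun p => f p.2 * dx ρ W p) q) (strip ρ) := by
    intro q hq
    simp only
    rw [h.R_eq q hq]
    have := (h.f_pos q.2 hq.2).ne'
    have := (Real.exp_pos (W q)).ne'
    field_simp
  have hq : (t, x) ∈ strip ρ := ⟨ht, hx⟩
  rw [dt, dirDeriv_congr h1 hq]
  have hPx := contDiffOn_dirDeriv hU (0, 1) hP
  have h2 := (hasDerivAt_dt hPx.neg ht hx).unique (hasDerivAt_dt hPx ht hx).neg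
  change dt ρ (fun q => -dx ρ (fun p => f p.2 * dx ρ W p) q) (t, x) = _
  refine h2.trans ?_
  change -dirDeriv _ (1, 0) (dirDeriv _ (0, 1) _) (t, x) = _
  rw [dirDeriv_comm hU (strip_subset_closure h.hρ) (1, 0) (0, 1) hP hq]
  have h3 : EqOn (dirDeriv (strip ρ) (1, 0) (fun p => f p.2 * dx ρ W p))
      (fun p => -(f p.2 * dx ρ R p)) (strip ρ) := fun p hp => h.dt_flux_W hp.1 hp.2
  rw [dirDeriv_congr h3 hq]
  have hQ := h.flux_smooth h.R_smooth
  have h4 := unique_dx h.hρ hQ.neg ht hx (hasDerivWithinAt_dx hQ ht hx).neg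
  change -dx ρ (fun p => -(f p.2 * dx ρ R p)) (t, x) = _
  rw [neg_eq_iff_eq_neg]
  exact h4

theorem hasDerivAt_density (h : CylFlow ρ c₁ c₂ f W R a) {t x : ℝ} (ht : 0 < t)
    (hx : x ∈ Icc (-ρ) ρ) :
    HasDerivAt (fun s => Real.exp (W (s, x)) / f x)
      (Real.exp (W (t, x)) / f x * (a t - R (t, x))) t := by
  refine ((h.W_deriv t ht x hx).exp.div_const (f x)).congr_deriv ?_
  ring

/-- The evolution equation of the scalar curvature. -/
theorem dt_R (h : CylFlow ρ c₁ c₂ f W R a) {t x : ℝ} (ht : 0 < t) (hx : x ∈ Icc (-ρ) ρ) :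
    dt ρ R (t, x) = f x / Real.exp (W (t, x)) * dx ρ (fun p => f p.2 * dx ρ R p) (t, x)
      - (a t - R (t, x)) * R (t, x) := by
  have h1 := (h.hasDerivAt_density ht hx).mul (hasDerivAt_dt h.R_smooth ht hx)
  have h2 := (hasDerivAt_dt (h.density_smooth.mul h.R_smooth) ht hx).unique h1
  have h3 := (h.dt_mass ht hx).symm.trans h2
  rw [h3]
  have := (h.f_pos x hx).ne'
  have := (Real.exp_pos (W (t, x))).ne'
  field_simp
  ring

/-- The time derivative of the boundary condition for `W`: since `W - ∫ a` has derivative `-R`, it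
becomes a Robin condition for `R`, dissipative because `c₁ ≥ 0`. -/
theorem bdry_R_right (h : CylFlow ρ c₁ c₂ f W R a) {t : ℝ} (ht : 0 < t) :
    f ρ * dx ρ R (t, ρ)
      = -(c₁ * Real.exp ((W (t, ρ) - ∫ s in (0 : ℝ)..t, a s) / 2) * R (t, ρ)) := by
  have hx := h.right_mem
  have h1 := hasDerivAt_dt (h.flux_smooth h.W_smooth) ht hx
  have h2 := ((((h.W_deriv t ht ρ hx).sub (h.hasDerivAt_intAvg ht)).div_const 2).exp).const_mul
    (-2 * c₁)
  have h3 := h1.unique (h2.congr_of_eventuallyEq (by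
    filter_upwards [Ioi_mem_nhds ht] with s hs using h.bdry_right s hs))
  rw [h.dt_flux_W ht hx] at h3
  simp only [Pi.sub_apply] at h3
  linear_combination -h3

theorem bdry_R_left (h : CylFlow ρ c₁ c₂ f W R a) {t : ℝ} (ht : 0 < t) :
    f (-ρ) * dx ρ R (t, -ρ)
      = c₂ * Real.exp ((W (t, -ρ) - ∫ s in (0 : ℝ)..t, a s) / 2) * R (t, -ρ) := by
  have hx := h.left_mem
  have h1 := hasDerivAt_dt (h.flux_smooth h.W_smooth) ht hx
  have h2 := ((((h.W_deriv t ht (-ρ) hx).sub (h.hasDerivAt_intAvg ht)).div_const 2).exp).const_mul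
    (2 * c₂)
  have h3 := h1.unique (h2.congr_of_eventuallyEq (by
    filter_upwards [Ioi_mem_nhds ht] with s hs using h.bdry_left s hs))
  rw [h.dt_flux_W ht hx] at h3
  simp only [Pi.sub_apply] at h3
  linear_combination -h3

/-- At a spatial maximum of `σ R`, where `σ R` is non-negative, the Laplacian of `σ R` is
non-positive, the boundary included. -/
theorem laplacian_nonpos_of_max (h : CylFlow ρ c₁ c₂ f W R a) (σ : ℝ) {t x : ℝ} (ht : 0 < t)
    (hx : x ∈ Icc (-ρ) ρ) (hmax : ∀ y ∈ Icc (-ρ) ρ, σ * R (t, y) ≤ σ * R (t, x))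
    (hpos : 0 ≤ σ * R (t, x)) :
    σ * dx ρ (fun p => f p.2 * dx ρ R p) (t, x) ≤ 0 := by
  refine deriv_flux_nonpos_of_max (u := fun y => σ * R (t, y)) (m := fun y => 1 / f y)
    (q := fun y => σ * (f y * dx ρ R (t, y))) (by linarith [h.hρ] : -ρ < ρ) hx ?_ ?_ hmax ?_ ?_ ?_
  · intro y hy
    refine ((hasDerivWithinAt_dx h.R_smooth ht hy).const_mul σ).congr_deriv ?_
    have := (h.f_pos y hy).ne'
    field_simp
  · exact fun y hy => one_div_pos.2 (h.f_pos y hy)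
  · rintro rfl
    rw [h.bdry_R_right ht]
    have := mul_nonneg (mul_nonneg h.hc₁
      (Real.exp_pos ((W (t, x) - ∫ s in (0 : ℝ)..t, a s) / 2)).le) hpos
    linarith
  · rintro rfl
    rw [h.bdry_R_left ht]
    have := mul_nonneg (mul_nonneg h.hc₂
      (Real.exp_pos ((W (t, -ρ) - ∫ s in (0 : ℝ)..t, a s) / 2)).le) hpos
    linarith
  · exact (hasDerivWithinAt_dx (h.flux_smooth h.R_smooth) ht hx).const_mul σ

/-- This bound depends on `T`; it only supplies the constant in the maximum principle. -/
theorem exists_bound (h : CylFlow ρ c₁ c₂ f W R a) (T : ℝ) :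
    ∃ B, 0 ≤ B ∧ ∀ t ∈ Icc 0 T, |a t| ≤ B ∧ ∀ x ∈ Icc (-ρ) ρ, |R (t, x)| ≤ B := by
  obtain ⟨B₁, h1⟩ := isCompact_Icc.exists_bound_of_continuousOn
    (h.avg_cont.mono (Icc_subset_Ici_self : Icc 0 T ⊆ Ici 0))
  obtain ⟨B₂, h2⟩ := (isCompact_Icc.prod isCompact_Icc).exists_bound_of_continuousOn
    (h.R_cont.mono (prod_mono (Icc_subset_Ici_self : Icc 0 T ⊆ Ici 0) subset_rfl))
  refine ⟨|B₁| + |B₂|, by positivity, fun t ht => ⟨(h1 t ht).trans ?_, fun x hx =>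
    (h2 (t, x) ⟨ht, hx⟩).trans ?_⟩⟩
  · linarith [le_abs_self B₁, abs_nonneg B₂]
  · linarith [le_abs_self B₂, abs_nonneg B₁]

/-- The maximum principle for `-R`: the reaction term is `(R - a) * (-R)`, and `R - a ≤ 2 B` up to
the given time. -/
theorem R_nonneg (h : CylFlow ρ c₁ c₂ f W R a) {t x : ℝ} (ht : 0 ≤ t) (hx : x ∈ Icc (-ρ) ρ) :
    0 ≤ R (t, x) := by
  obtain ⟨B, hB, hbd⟩ := h.exists_bound t
  have := nonpos_of_deriv_le_at_max (isCompact_Icc (a := -ρ) (b := ρ)) (t₀ := 0) (T := t)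
    (C := 2 * B) (D := fun q => -R q)
    (h.R_cont.neg.mono (prod_mono Icc_subset_Ici_self subset_rfl))
    (fun y hy => neg_nonpos.2 (h.R_zero y hy)) (by
      intro s hs y hy hmax hpos
      refine ⟨_, (hasDerivAt_dt h.R_smooth hs.1 hy).neg, ?_⟩
      rw [h.dt_R hs.1 hy]
      have h1 := h.laplacian_nonpos_of_max (-1) hs.1 hy (by simpa using hmax)
        (by simpa using hpos.le)
      have h2 : 0 < f y / Real.exp (W (s, y)) := div_pos (h.f_pos y hy) (Real.exp_pos _)
      have h3 := mul_nonpos_of_nonneg_of_nonpos h2.le h1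
      obtain ⟨h4, h5⟩ := hbd s ⟨hs.1.le, hs.2⟩
      have h6 := abs_le.1 h4
      have h7 := abs_le.1 (h5 y hy)
      have h8 : R (s, y) - a s ≤ 2 * B := by linarith
      nlinarith [mul_le_mul_of_nonneg_right h8 hpos.le]) t ⟨ht, le_rfl⟩ x hx
  linarith

theorem avg_nonneg (h : CylFlow ρ c₁ c₂ f W R a) {t : ℝ} (ht : 0 ≤ t) : 0 ≤ a t := by
  rw [h.avg t ht]
  refine mul_nonneg (by positivity) (intervalIntegral.integral_nonneg (by linarith [h.hρ]) ?_)
  exact fun x hx => mul_nonneg (h.density_pos t hx).le (h.R_nonneg ht hx)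

/-- A small curvature bound is preserved, up to a factor, for one unit of time. -/
theorem R_le_of_le (h : CylFlow ρ c₁ c₂ f W R a) {t₀ δ : ℝ} (ht₀ : 0 < t₀) (hδ : 0 < δ)
    (hδ' : δ ≤ 2 / 9) (hR : ∀ x ∈ Icc (-ρ) ρ, R (t₀, x) ≤ δ) {t x : ℝ}
    (ht : t ∈ Icc t₀ (t₀ + 1)) (hx : x ∈ Icc (-ρ) ρ) : R (t, x) ≤ 3 * δ := by
  obtain ⟨B, hB, hbd⟩ := h.exists_bound (t₀ + 1)
  -- The barrier `b = δ (1 + 2 (t - t₀))` has slope `2 δ`. Since `b ≤ 3 δ` and `δ ≤ 2 / 9`, this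
  -- slope is at least `b²`, so the excess `R - b` grows at most at the rate `R + b ≤ B + 1`.
  have := nonpos_of_deriv_le_at_max (isCompact_Icc (a := -ρ) (b := ρ)) (t₀ := t₀) (T := t₀ + 1)
    (C := B + 1) (D := fun q => R q - δ * (1 + 2 * (q.1 - t₀)))
    (by
      refine (h.R_cont.mono (prod_mono (fun s hs => ht₀.le.trans hs.1) subset_rfl)).sub ?_
      fun_prop)
    (fun y hy => by simpa using hR y hy) (by
      intro s hs y hy hmax hpos
      simp only at hpos hmax ⊢
      have hs0 : 0 < s := ht₀.trans hs.1
      have hlin : HasDerivAt (fun s => δ * (1 + 2 * (s - t₀))) (2 * δ) s := by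
        refine (((((hasDerivAt_id s).sub_const t₀).const_mul 2).const_add 1).const_mul δ).congr_deriv
          ?_
        ring
      refine ⟨_, (hasDerivAt_dt h.R_smooth hs0 hy).sub hlin, ?_⟩
      rw [h.dt_R hs0 hy]
      have h1 := h.laplacian_nonpos_of_max 1 hs0 hy
        (by intro z hz; linarith [hmax z hz]) (by linarith [h.R_nonneg hs0.le hy])
      have h2 : 0 < f y / Real.exp (W (s, y)) := div_pos (h.f_pos y hy) (Real.exp_pos _)
      have h3 := mul_nonpos_of_nonneg_of_nonpos h2.le h1
      have h5 := (abs_le.1 ((hbd s ⟨hs0.le, hs.2⟩).2 y hy)).2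
      have h6 := mul_nonneg (h.avg_nonneg hs0.le) (h.R_nonneg hs0.le hy)
      set b := δ * (1 + 2 * (s - t₀)) with hb
      have hb1 : b ≤ 3 * δ := by nlinarith [hs.2]
      have hb0 : 0 ≤ b := mul_nonneg hδ.le (by linarith [hs.1])
      have hb2 : b ^ 2 ≤ 2 * δ := by nlinarith
      have hb3 : b ≤ 1 := by linarith
      nlinarith [mul_le_mul_of_nonneg_right (show R (s, y) + b ≤ B + 1 by linarith) hpos.le])
    t ht x hx
  nlinarith [ht.2, ht.1]

/-- Here `a` is the total curvature, not divided by the area `A`, so `A' = a (A - 1)`. Hence `(A -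
1) * exp (-∫ a)` is constant, and it vanishes initially. -/
theorem area_eq (h : CylFlow ρ c₁ c₂ f W R a) {t : ℝ} (ht : 0 ≤ t) :
    2 * Real.pi * ∫ x in (-ρ)..ρ, Real.exp (W (t, x)) / f x = 1 := by
  have hle : -ρ ≤ ρ := by linarith [h.hρ]
  have key := eq_of_hasDerivAt_zero
    (u := fun t => (2 * Real.pi * (∫ x in (-ρ)..ρ, Real.exp (W (t, x)) / f x) - 1)
      * Real.exp (-∫ s in (0 : ℝ)..t, a s))
    (((continuousOn_const.mul (continuousOn_integral_slice h.hρ h.density_cont)).sub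
      continuousOn_const).mul (Real.continuous_exp.comp_continuousOn h.intAvg_cont.neg))
    (fun t ht => by
      have h1 := hasDerivAt_integral_dt h.hρ h.density_smooth ht
      have h2 : ∫ x in (-ρ)..ρ, dt ρ (fun q => Real.exp (W q) / f q.2) (t, x)
          = a t * (∫ x in (-ρ)..ρ, Real.exp (W (t, x)) / f x)
            - ∫ x in (-ρ)..ρ, Real.exp (W (t, x)) / f x * R (t, x) := by
        rw [← intervalIntegral.integral_const_mul, ← intervalIntegral.integral_sub]
        · refine intervalIntegral.integral_congr fun x hx => ?_
          rw [uIcc_of_le hle] at hx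
          rw [(hasDerivAt_dt h.density_smooth ht hx).unique (h.hasDerivAt_density ht hx)]
          ring
        · exact (intervalIntegrable_slice h.hρ h.density_cont (mem_Ici.2 ht.le)).const_mul _
        · exact intervalIntegrable_slice h.hρ (h.density_cont.mul h.R_cont) (mem_Ici.2 ht.le)
      refine (((h1.const_mul (2 * Real.pi)).sub_const 1).mul
        (h.hasDerivAt_intAvg ht).neg.exp).congr_deriv ?_
      rw [h2]
      linear_combination (-Real.exp (-∫ s in (0 : ℝ)..t, a s)) * -h.avg t ht.le) ht
  simp only [intervalIntegral.integral_same, h.area_zero, sub_self, zero_mul] at key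
  have := (mul_eq_zero.1 key).resolve_right (Real.exp_pos _).ne'
  linarith

end CylFlow
end Cylinder

/-! ### The radial flow: decay of the average curvature, of the energy and of the curvature -/

namespace Cylinder
namespace CylFlow

variable {ρ c₁ c₂ : ℝ} {f : ℝ → ℝ} {W R : ℝ × ℝ → ℝ} {a : ℝ → ℝ}

/-- The left-hand side is the log factor of the unnormalised flow; its time derivative is `-R ≤ 0`.
-/
theorem W_sub_intAvg_le (h : CylFlow ρ c₁ c₂ f W R a) {t x : ℝ} (ht : 0 ≤ t)
    (hx : x ∈ Icc (-ρ) ρ) : W (t, x) - ∫ s in (0 : ℝ)..t, a s ≤ W (0, x) := by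
  have hc : ContinuousOn (fun t => W (t, x) - ∫ s in (0 : ℝ)..t, a s) (Ici 0) :=
    (h.W_cont.comp (by fun_prop) fun s hs => ⟨hs, hx⟩).sub h.intAvg_cont
  have hd : ∀ t ∈ interior (Ici (0 : ℝ)),
      HasDerivAt (fun t => W (t, x) - ∫ s in (0 : ℝ)..t, a s) (-R (t, x)) t := by
    intro t ht
    rw [interior_Ici] at ht
    refine ((h.W_deriv t ht x hx).sub (h.hasDerivAt_intAvg ht)).congr_deriv ?_
    ring
  have := antitoneOn_of_deriv_nonpos (convex_Ici 0) hc
    (fun t ht => (hd t ht).differentiableAt.differentiableWithinAt)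
    (fun t ht => by
      rw [(hd t ht).deriv, neg_nonpos]
      exact h.R_nonneg (interior_subset ht) hx) (mem_Ici.2 le_rfl) (mem_Ici.2 ht) ht
  simpa using this

theorem dx_flux_W (h : CylFlow ρ c₁ c₂ f W R a) {t x : ℝ} (ht : 0 < t) (hx : x ∈ Icc (-ρ) ρ) :
    dx ρ (fun p => f p.2 * dx ρ W p) (t, x) = -(Real.exp (W (t, x)) / f x * R (t, x)) := by
  rw [h.R_eq (t, x) ⟨ht, hx⟩]
  have := (h.f_pos x hx).ne'
  have := (Real.exp_pos (W (t, x))).ne'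
  field_simp

theorem flux_W_antitone (h : CylFlow ρ c₁ c₂ f W R a) {t : ℝ} (ht : 0 < t) :
    AntitoneOn (fun x => f x * dx ρ W (t, x)) (Icc (-ρ) ρ) := by
  have hd := fun x (hx : x ∈ Icc (-ρ) ρ) =>
    hasDerivWithinAt_dx (h.flux_smooth h.W_smooth) ht hx
  refine antitoneOn_of_hasDerivWithinAt_nonpos (convex_Icc _ _)
    (fun x hx => (hd x hx).continuousWithinAt)
    (fun x hx => (hd x (interior_subset hx)).mono interior_subset) fun x hx => ?_
  have hx' := interior_subset hx
  rw [h.dx_flux_W ht hx', neg_nonpos]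
  exact mul_nonneg (h.density_pos t hx').le (h.R_nonneg ht.le hx')

/-- The flux `f W_x` is antitone in space, hence lies between its boundary values. Those are
controlled by the initial metric, since `W - ∫ a` only decreases. Division by the minimum of `f`
gives a Lipschitz bound uniform in time. -/
theorem exists_W_osc_bound (h : CylFlow ρ c₁ c₂ f W R a) :
    ∃ K, ∀ t, 0 < t → ∀ x ∈ Icc (-ρ) ρ, ∀ y ∈ Icc (-ρ) ρ, W (t, x) ≤ W (t, y) + K := by
  have hl := h.left_mem
  have hr := h.right_mem
  set C := 2 * c₁ * Real.exp (W (0, ρ) / 2) + 2 * c₂ * Real.exp (W (0, -ρ) / 2) with hC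
  have e1 : 0 ≤ 2 * c₁ * Real.exp (W (0, ρ) / 2) := by have := h.hc₁; positivity
  have e2 : 0 ≤ 2 * c₂ * Real.exp (W (0, -ρ) / 2) := by have := h.hc₂; positivity
  have hC0 : 0 ≤ C := add_nonneg e1 e2
  obtain ⟨z, hz, hmin⟩ := isCompact_Icc.exists_isMinOn ⟨ρ, hr⟩ h.f_smooth.continuousOn
  have hfz := h.f_pos z hz
  refine ⟨C / f z * (2 * ρ), fun t ht x hx y hy => ?_⟩
  have hflux : ∀ x ∈ Icc (-ρ) ρ, |f x * dx ρ W (t, x)| ≤ C := by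
    intro x hx
    have h1 := h.flux_W_antitone ht hl hx hx.1
    have h2 := h.flux_W_antitone ht hx hr hx.2
    simp only at h1 h2
    rw [h.bdry_left t ht] at h1
    rw [h.bdry_right t ht] at h2
    have h3 := mul_le_mul_of_nonneg_left (Real.exp_le_exp.2
      (div_le_div_of_nonneg_right (h.W_sub_intAvg_le ht.le hl) zero_le_two))
      (show 0 ≤ 2 * c₂ by linarith [h.hc₂])
    have h4 := mul_le_mul_of_nonneg_left (Real.exp_le_exp.2
      (div_le_div_of_nonneg_right (h.W_sub_intAvg_le ht.le hr) zero_le_two))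
      (show 0 ≤ 2 * c₁ by linarith [h.hc₁])
    rw [abs_le]
    constructor <;> linarith
  have hbd : ∀ x ∈ Icc (-ρ) ρ, ‖dx ρ W (t, x)‖ ≤ C / f z := by
    intro x hx
    have hfx := h.f_pos x hx
    have h1 := hflux x hx
    rw [abs_mul, abs_of_pos hfx] at h1
    rw [Real.norm_eq_abs, le_div_iff₀ hfz]
    have h2 : f z ≤ f x := hmin hx
    nlinarith [abs_nonneg (dx ρ W (t, x))]
  have h5 := (convex_Icc (-ρ) ρ).norm_image_sub_le_of_norm_hasDerivWithin_le
    (fun x hx => hasDerivWithinAt_dx h.W_smooth ht hx) hbd hy hx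
  have h6 : ‖x - y‖ ≤ 2 * ρ := by
    rw [Real.norm_eq_abs, abs_le]
    constructor <;> linarith [hx.1, hx.2, hy.1, hy.2]
  have h7 := mul_le_mul_of_nonneg_left h6 (div_nonneg hC0 hfz.le)
  linarith [Real.le_norm_self (W (t, x) - W (t, y))]

theorem integral_inv_pos (h : CylFlow ρ c₁ c₂ f W R a) : 0 < ∫ x in (-ρ)..ρ, 1 / f x := by
  refine intervalIntegral.intervalIntegral_pos_of_pos_on ?_
    (fun x hx => one_div_pos.2 (h.f_pos x (Ioo_subset_Icc_self hx))) (by linarith [h.hρ])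
  apply ContinuousOn.intervalIntegrable
  rw [uIcc_of_le (by linarith [h.hρ])]
  exact continuousOn_const.div h.f_smooth.continuousOn fun x hx => (h.f_pos x hx).ne'

/-- Area one makes `v = 1 / (2 π J)` the weighted average of `exp W`, which therefore takes values
on both sides of `v`; the oscillation bound spreads this to every point. -/
theorem exists_exp_bounds (h : CylFlow ρ c₁ c₂ f W R a) :
    ∃ m M, 0 < m ∧ 0 < M ∧ ∀ t, 0 < t → ∀ x ∈ Icc (-ρ) ρ,
      m ≤ Real.exp (W (t, x) / 2) ∧ Real.exp (W (t, x) / 2) ≤ M := by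
  obtain ⟨K, hK⟩ := h.exists_W_osc_bound
  set J := ∫ x in (-ρ)..ρ, 1 / f x with hJ
  have hJpos : 0 < J := h.integral_inv_pos
  set v := 1 / (2 * Real.pi * J) with hv
  have hvpos : 0 < v := by positivity
  refine ⟨Real.exp ((Real.log v - K) / 2), Real.exp ((Real.log v + K) / 2), Real.exp_pos _,
    Real.exp_pos _, fun t ht x hx => ?_⟩
  have hρ := h.hρ
  have hcW : ContinuousOn (fun x => Real.exp (W (t, x))) (Icc (-ρ) ρ) :=
    Real.continuous_exp.comp_continuousOn (continuousOn_slice h.W_cont (mem_Ici.2 ht.le))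
  have hcf : ContinuousOn (fun x => 1 / f x) (Icc (-ρ) ρ) :=
    continuousOn_const.div h.f_smooth.continuousOn fun x hx => (h.f_pos x hx).ne'
  have hpos : ∀ x ∈ Icc (-ρ) ρ, 0 < 1 / f x := fun x hx => one_div_pos.2 (h.f_pos x hx)
  have harea : ∫ x in (-ρ)..ρ, 1 / f x * Real.exp (W (t, x)) = v * J := by
    have h1 := h.area_eq ht.le
    have h2 : (fun x => 1 / f x * Real.exp (W (t, x))) = fun x => Real.exp (W (t, x)) / f x := by
      ext x; ring
    rw [h2]
    have h3 : v * J = 1 / (2 * Real.pi) := by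
      rw [hv]; field_simp
    rw [h3, eq_div_iff (by positivity)]
    linarith
  obtain ⟨y, hy, hyv⟩ := exists_le_of_weighted_average (by linarith) hcW hcf hpos harea
  -- The change of sign produces a point where `exp W` is at least `v`.
  obtain ⟨z, hz, hzv⟩ := exists_le_of_weighted_average (v := -v)
    (h := fun x => -Real.exp (W (t, x))) (by linarith) hcW.neg hcf hpos (by
      simp only [mul_neg, intervalIntegral.integral_neg, neg_mul]
      exact congrArg Neg.neg harea)
  have h1 : W (t, y) ≤ Real.log v := (Real.le_log_iff_exp_le hvpos).2 hyv
  have h2 : Real.log v ≤ W (t, z) := (Real.log_le_iff_le_exp hvpos).2 (by linarith)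
  exact ⟨Real.exp_le_exp.2 (by linarith [hK t ht z hz x hx]),
    Real.exp_le_exp.2 (by linarith [hK t ht x hx y hy])⟩

/-- The Gauss–Bonnet formula. -/
theorem avg_eq (h : CylFlow ρ c₁ c₂ f W R a) {t : ℝ} (ht : 0 < t) :
    a t * Real.exp ((∫ s in (0 : ℝ)..t, a s) / 2) = 4 * Real.pi *
      (c₁ * Real.exp (W (t, ρ) / 2) + c₂ * Real.exp (W (t, -ρ) / 2)) := by
  have hle : -ρ ≤ ρ := by linarith [h.hρ]
  have h1 := integral_eq_sub_of_hasDerivWithinAt hle (subset_refl (Icc (-ρ) ρ))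
    (fun x hx => hasDerivWithinAt_dx (h.flux_smooth h.W_smooth) ht hx)
    (continuousOn_slice (contDiffOn_dirDeriv (uniqueDiffOn_strip h.hρ) _
      (h.flux_smooth h.W_smooth)).continuousOn ht)
  have h2 : ∫ x in (-ρ)..ρ, dx ρ (fun p => f p.2 * dx ρ W p) (t, x)
      = -∫ x in (-ρ)..ρ, Real.exp (W (t, x)) / f x * R (t, x) := by
    rw [← intervalIntegral.integral_neg]
    refine intervalIntegral.integral_congr fun x hx => ?_
    rw [uIcc_of_le hle] at hx
    exact h.dx_flux_W ht hx
  simp only at h1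
  rw [h2, h.bdry_left t ht, h.bdry_right t ht] at h1
  have h3 : ∀ x, Real.exp ((W (t, x) - ∫ s in (0 : ℝ)..t, a s) / 2)
      * Real.exp ((∫ s in (0 : ℝ)..t, a s) / 2) = Real.exp (W (t, x) / 2) := by
    intro x
    rw [← Real.exp_add]
    congr 1
    ring
  rw [h.avg t ht.le, ← h3 ρ, ← h3 (-ρ)]
  linear_combination (-2 * Real.pi * Real.exp ((∫ s in (0 : ℝ)..t, a s) / 2)) * h1

/-- With `ψ = exp (∫ a / 2)`, Gauss–Bonnet puts `a ψ = 2 ψ'` between `4 π c m` and `4 π c M`. So `ψ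
≥ 2 π c m t`, and the quotient of the two bounds is `2 M / (m t)`. Nothing is divided by `c`, so `c
= 0` is covered. -/
theorem exists_avg_le (h : CylFlow ρ c₁ c₂ f W R a) :
    ∃ C, 0 < C ∧ ∀ t, 0 < t → a t ≤ C / t := by
  obtain ⟨m, M, hm, hM, hbd⟩ := h.exists_exp_bounds
  refine ⟨2 * M / m, by positivity, fun t ht => ?_⟩
  set c := c₁ + c₂ with hc
  have hc1 := h.hc₁
  have hc2 := h.hc₂
  have hlow : ∀ s, 0 < s → 4 * Real.pi * c * m
      ≤ a s * Real.exp ((∫ s in (0 : ℝ)..s, a s) / 2) := by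
    intro s hs
    rw [h.avg_eq hs, mul_assoc]
    refine mul_le_mul_of_nonneg_left ?_ (by positivity)
    nlinarith [mul_le_mul_of_nonneg_left (hbd s hs ρ h.right_mem).1 hc1,
      mul_le_mul_of_nonneg_left (hbd s hs (-ρ) h.left_mem).1 hc2]
  have hup : a t * Real.exp ((∫ s in (0 : ℝ)..t, a s) / 2) ≤ 4 * Real.pi * c * M := by
    rw [h.avg_eq ht, mul_assoc (4 * Real.pi) c]
    refine mul_le_mul_of_nonneg_left ?_ (by positivity)
    nlinarith [mul_le_mul_of_nonneg_left (hbd t ht ρ h.right_mem).2 hc1,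
      mul_le_mul_of_nonneg_left (hbd t ht (-ρ) h.left_mem).2 hc2]
  have hderiv : ∀ s, 0 < s → HasDerivAt (fun s => Real.exp ((∫ s in (0 : ℝ)..s, a s) / 2))
      (Real.exp ((∫ s in (0 : ℝ)..s, a s) / 2) * (a s / 2)) s :=
    fun s hs => ((h.hasDerivAt_intAvg hs).div_const 2).exp
  obtain ⟨s, hs, hs'⟩ := exists_hasDerivAt_eq_slope
    (fun s => Real.exp ((∫ s in (0 : ℝ)..s, a s) / 2)) _ ht
    ((Real.continuous_exp.comp_continuousOn (h.intAvg_cont.div_const 2)).mono Icc_subset_Ici_self)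
    (fun s hs => hderiv s hs.1)
  rw [intervalIntegral.integral_same, zero_div, Real.exp_zero, sub_zero, eq_div_iff ht.ne'] at hs'
  set ψ := Real.exp ((∫ s in (0 : ℝ)..t, a s) / 2) with hψ
  have hψpos : 0 < ψ := Real.exp_pos _
  have h1 : 2 * Real.pi * c * m * t ≤ ψ := by
    nlinarith [mul_le_mul_of_nonneg_right (hlow s hs.1) ht.le]
  rw [le_div_iff₀ ht, le_div_iff₀ hm]
  refine le_of_mul_le_mul_right ?_ hψpos
  nlinarith [mul_le_mul_of_nonneg_right hup (mul_pos ht hm).le,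
    mul_le_mul_of_nonneg_left h1 hM.le]

theorem dx_R_cont (h : CylFlow ρ c₁ c₂ f W R a) {t : ℝ} (ht : 0 < t) :
    ContinuousOn (fun x => dx ρ R (t, x)) (Icc (-ρ) ρ) :=
  continuousOn_slice (contDiffOn_dirDeriv (uniqueDiffOn_strip h.hρ) _ h.R_smooth).continuousOn ht

/-- The curvature is controlled by its average and its Dirichlet energy. -/
theorem R_sq_le (h : CylFlow ρ c₁ c₂ f W R a) {t x : ℝ} (ht : 0 < t) (hx : x ∈ Icc (-ρ) ρ) :
    R (t, x) ^ 2 ≤ 2 * a t ^ 2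
      + 2 * ((∫ y in (-ρ)..ρ, 1 / f y) * ∫ y in (-ρ)..ρ, f y * dx ρ R (t, y) ^ 2) := by
  -- As the area is one, `a` is the mean of `R`, so `R ≤ a` at some `y`. Where `R` exceeds `a`, the
  -- excess is at most the oscillation from `y`.
  obtain ⟨y, hy, hya⟩ := exists_le_of_weighted_average (v := a t) (by linarith [h.hρ] : -ρ < ρ)
    (continuousOn_slice h.R_cont (mem_Ici.2 ht.le))
    (continuousOn_slice h.density_cont (mem_Ici.2 ht.le)) (fun x hx => h.density_pos t hx) (by
      have h1 := h.avg t ht.le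
      have h2 := h.area_eq ht.le
      have : (2 * Real.pi) ≠ 0 := by positivity
      apply mul_left_cancel₀ this
      linear_combination a t * (-h2) - h1)
  have h1 := sq_sub_le_integral_mul hx hy h.f_pos h.f_smooth.continuousOn
    (fun z hz => hasDerivWithinAt_dx h.R_smooth ht hz) (h.dx_R_cont ht)
  have h2 := h.R_nonneg ht.le hx
  have h3 := h.avg_nonneg ht.le
  by_cases h4 : R (t, x) ≤ a t
  · nlinarith [sq_nonneg (R (t, x) - R (t, y)), sq_nonneg (a t)]
  · have h5 : (R (t, x) - a t) ^ 2 ≤ (R (t, x) - R (t, y)) ^ 2 :=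
      pow_le_pow_left₀ (by linarith) (by linarith) 2
    nlinarith [sq_nonneg (R (t, x) - 2 * a t)]

/-- The decay of the `L²` norm of the curvature. -/
theorem exists_energy_deriv (h : CylFlow ρ c₁ c₂ f W R a) {t : ℝ} (ht : 0 < t) :
    ∃ e, HasDerivAt (fun t => ∫ x in (-ρ)..ρ, Real.exp (W (t, x)) / f x * R (t, x) * R (t, x)) e t
      ∧ e ≤ -2 * (∫ x in (-ρ)..ρ, f x * dx ρ R (t, x) ^ 2)
        + ∫ x in (-ρ)..ρ, Real.exp (W (t, x)) / f x * R (t, x) ^ 3 := by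
  have hle : -ρ ≤ ρ := by linarith [h.hρ]
  have hU := uniqueDiffOn_strip h.hρ
  have hmass := h.density_smooth.mul h.R_smooth
  have hQ := h.flux_smooth h.R_smooth
  have hQx := contDiffOn_dirDeriv hU (0, 1) hQ
  have hRx := contDiffOn_dirDeriv hU (0, 1) h.R_smooth
  refine ⟨_, hasDerivAt_integral_dt h.hρ (hmass.mul h.R_smooth) ht, ?_⟩
  -- Integration by parts; the Robin conditions give both boundary terms the favourable sign.
  have h1 : ∫ x in (-ρ)..ρ, (dx ρ R (t, x) * (f x * dx ρ R (t, x))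
      + R (t, x) * dx ρ (fun p => f p.2 * dx ρ R p) (t, x))
      = R (t, ρ) * (f ρ * dx ρ R (t, ρ)) - R (t, -ρ) * (f (-ρ) * dx ρ R (t, -ρ)) :=
    integral_eq_sub_of_hasDerivWithinAt hle (subset_refl (Icc (-ρ) ρ))
      (u := fun x => R (t, x) * (f x * dx ρ R (t, x)))
      (fun x hx => (hasDerivWithinAt_dx h.R_smooth ht hx).mul (hasDerivWithinAt_dx hQ ht hx))
      (continuousOn_slice ((hRx.mul hQ).add (h.R_smooth.mul hQx)).continuousOn ht)
  have hb1 : R (t, ρ) * (f ρ * dx ρ R (t, ρ)) ≤ 0 := by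
    rw [h.bdry_R_right ht]
    have : 0 ≤ c₁ * Real.exp ((W (t, ρ) - ∫ s in (0 : ℝ)..t, a s) / 2) * R (t, ρ) ^ 2 :=
      mul_nonneg (mul_nonneg h.hc₁ (Real.exp_pos _).le) (sq_nonneg _)
    linarith
  have hb2 : 0 ≤ R (t, -ρ) * (f (-ρ) * dx ρ R (t, -ρ)) := by
    rw [h.bdry_R_left ht]
    have : 0 ≤ c₂ * Real.exp ((W (t, -ρ) - ∫ s in (0 : ℝ)..t, a s) / 2) * R (t, -ρ) ^ 2 :=
      mul_nonneg (mul_nonneg h.hc₂ (Real.exp_pos _).le) (sq_nonneg _)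
    linarith
  have hi : ∀ {u : ℝ × ℝ → ℝ}, ContDiffOn ℝ ∞ u (strip ρ) →
      IntervalIntegrable (fun x => u (t, x)) MeasureTheory.volume (-ρ) ρ :=
    fun hu => intervalIntegrable_slice h.hρ hu.continuousOn ht
  have i1 := hi ((hRx.mul hQ).add (h.R_smooth.mul hQx))
  have i2 := hi (h.f_smooth'.mul (hRx.pow 2))
  have i3 := hi (h.density_smooth.mul (h.R_smooth.pow 3))
  have h2 : ∫ x in (-ρ)..ρ, dt ρ (fun q => Real.exp (W q) / f q.2 * R q * R q) (t, x)
      ≤ ∫ x in (-ρ)..ρ, (2 * (dx ρ R (t, x) * (f x * dx ρ R (t, x))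
        + R (t, x) * dx ρ (fun p => f p.2 * dx ρ R p) (t, x)) - 2 * (f x * dx ρ R (t, x) ^ 2)
        + Real.exp (W (t, x)) / f x * R (t, x) ^ 3) := by
    refine intervalIntegral.integral_mono_on hle
      (hi (contDiffOn_dirDeriv hU (1, 0) (hmass.mul h.R_smooth)))
      (((i1.const_mul 2).sub (i2.const_mul 2)).add i3) fun x hx => ?_
    rw [(hasDerivAt_dt (hmass.mul h.R_smooth) ht hx).unique
      ((hasDerivAt_dt hmass ht hx).mul (hasDerivAt_dt h.R_smooth ht hx)), h.dt_mass ht hx,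
      h.dt_R ht hx]
    have hμ := h.density_pos t hx
    have h4 : Real.exp (W (t, x)) / f x * (f x / Real.exp (W (t, x))) = 1 := by
      have := (h.f_pos x hx).ne'
      have := (Real.exp_pos (W (t, x))).ne'
      field_simp
    -- The contribution of `-a R²` is non-positive and is dropped.
    have h5 : 0 ≤ Real.exp (W (t, x)) / f x * (a t * R (t, x) ^ 2) :=
      mul_nonneg hμ.le (mul_nonneg (h.avg_nonneg ht.le) (sq_nonneg _))
    linear_combination h5 + (R (t, x) * dx ρ (fun p => f p.2 * dx ρ R p) (t, x)) * h4
  refine h2.trans ?_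
  rw [intervalIntegral.integral_add ((i1.const_mul 2).sub (i2.const_mul 2)) i3,
    intervalIntegral.integral_sub (i1.const_mul 2) (i2.const_mul 2),
    intervalIntegral.integral_const_mul, intervalIntegral.integral_const_mul, h1]
  linarith

/-- Two factors of `R³` are bounded pointwise by `R_sq_le`; the third integrates to `I = a / (2 π)`,
and `2 I ≤ a`. The smallness of `J a` absorbs the energy term into a single copy of `D`. -/
theorem energy_cubic_le (h : CylFlow ρ c₁ c₂ f W R a) {t : ℝ} (ht : 0 < t)
    (hsmall : (∫ y in (-ρ)..ρ, 1 / f y) * a t ≤ 1) :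
    ∫ x in (-ρ)..ρ, Real.exp (W (t, x)) / f x * R (t, x) ^ 3
      ≤ (∫ x in (-ρ)..ρ, f x * dx ρ R (t, x) ^ 2) + a t ^ 3 := by
  have hle : -ρ ≤ ρ := by linarith [h.hρ]
  set J := ∫ y in (-ρ)..ρ, 1 / f y
  set D := ∫ x in (-ρ)..ρ, f x * dx ρ R (t, x) ^ 2 with hD
  have hD0 : 0 ≤ D := intervalIntegral.integral_nonneg hle fun x hx =>
    mul_nonneg (h.f_pos x hx).le (sq_nonneg _)
  have ha := h.avg_nonneg ht.le
  set I := ∫ x in (-ρ)..ρ, Real.exp (W (t, x)) / f x * R (t, x) with hI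
  have hI0 : 0 ≤ I := intervalIntegral.integral_nonneg hle fun x hx =>
    mul_nonneg (h.density_pos t hx).le (h.R_nonneg ht.le hx)
  have h1 : ∫ x in (-ρ)..ρ, Real.exp (W (t, x)) / f x * R (t, x) ^ 3
      ≤ ∫ x in (-ρ)..ρ, (2 * a t ^ 2 + 2 * (J * D)) * (Real.exp (W (t, x)) / f x * R (t, x)) := by
    refine intervalIntegral.integral_mono_on hle
      (intervalIntegrable_slice h.hρ (h.density_smooth.mul (h.R_smooth.pow 3)).continuousOn ht)
      ((intervalIntegrable_slice h.hρ (h.density_smooth.mul h.R_smooth).continuousOn ht).const_mul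
        _) fun x hx => ?_
    have h2 := mul_le_mul_of_nonneg_right (h.R_sq_le ht hx)
      (mul_nonneg (h.density_pos t hx).le (h.R_nonneg ht.le hx))
    refine le_trans (le_of_eq ?_) h2
    ring
  refine h1.trans ?_
  rw [intervalIntegral.integral_const_mul]
  have h3 : 2 * I ≤ a t := by
    rw [h.avg t ht.le, ← hI]
    nlinarith [Real.pi_gt_three]
  have h4 : (2 * a t ^ 2 + 2 * (J * D)) * I = (a t ^ 2 + J * D) * (2 * I) := by ring
  rw [h4]
  have hJ : 0 < J := h.integral_inv_pos
  calc (a t ^ 2 + J * D) * (2 * I) ≤ (a t ^ 2 + J * D) * a t :=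
        mul_le_mul_of_nonneg_left h3 (by positivity)
    _ = (J * a t) * D + a t ^ 3 := by ring
    _ ≤ 1 * D + a t ^ 3 := by gcongr
    _ = D + a t ^ 3 := by ring

/-- The curvature of a rotationally symmetric normalised flow tends to zero. -/
theorem exists_R_le (h : CylFlow ρ c₁ c₂ f W R a) {ε : ℝ} (hε : 0 < ε) :
    ∃ T, ∀ t, T ≤ t → ∀ x ∈ Icc (-ρ) ρ, R (t, x) ≤ ε := by
  have hle : -ρ ≤ ρ := by linarith [h.hρ]
  obtain ⟨C, hC, hCa⟩ := h.exists_avg_le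
  set J := ∫ y in (-ρ)..ρ, 1 / f y with hJdef
  have hJ : 0 < J := h.integral_inv_pos
  -- From this time on `J * a t ≤ J * C / t ≤ 1`.
  set T₀ := J * C + 1 with hT₀
  have hT₀pos : 0 < T₀ := by positivity
  set D : ℝ → ℝ := fun t => ∫ x in (-ρ)..ρ, f x * dx ρ R (t, x) ^ 2 with hD
  have hD0 : ∀ t, 0 ≤ D t := fun t => intervalIntegral.integral_nonneg hle fun x hx =>
    mul_nonneg (h.f_pos x hx).le (sq_nonneg _)
  -- The added term has derivative `-C³ / t³`, which cancels the bound for `a³`; hence `F' ≤ -D`.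
  set F : ℝ → ℝ := fun t => (∫ x in (-ρ)..ρ, Real.exp (W (t, x)) / f x * R (t, x) * R (t, x))
    + C ^ 3 / 2 * (t ^ 2)⁻¹ with hF
  have hF0 : ∀ t, 0 ≤ F t := fun t => add_nonneg
    (intervalIntegral.integral_nonneg hle fun x hx => by
      rw [mul_assoc]
      exact mul_nonneg (h.density_pos t hx).le (mul_self_nonneg _)) (by positivity)
  have hFd : ∀ t, T₀ ≤ t → ∃ e, HasDerivAt F e t ∧ e ≤ -D t := by
    intro t ht
    have ht0 : 0 < t := hT₀pos.trans_le ht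
    obtain ⟨e, he, hle'⟩ := h.exists_energy_deriv ht0
    have h1 : HasDerivAt (fun t : ℝ => C ^ 3 / 2 * (t ^ 2)⁻¹) (-(C ^ 3 / t ^ 3)) t := by
      refine (((hasDerivAt_pow 2 t).inv (by positivity)).const_mul (C ^ 3 / 2)).congr_deriv ?_
      field_simp
      norm_num
    refine ⟨_, he.add h1, ?_⟩
    have h2 := h.energy_cubic_le ht0 (by
      calc J * a t ≤ J * (C / t) := mul_le_mul_of_nonneg_left (hCa t ht0) hJ.le
        _ ≤ 1 := by
          rw [← mul_div_assoc, div_le_one ht0]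
          linarith)
    have h3 : a t ^ 3 ≤ C ^ 3 / t ^ 3 := by
      rw [← div_pow]
      exact pow_le_pow_left₀ (h.avg_nonneg ht0.le) (hCa t ht0) 3
    have h4 : D t = ∫ x in (-ρ)..ρ, f x * dx ρ R (t, x) ^ 2 := rfl
    linarith
  have hanti : AntitoneOn F (Ici T₀) := by
    choose! e he using hFd
    refine antitoneOn_of_hasDerivWithinAt_nonpos (convex_Ici _)
      (fun t ht => (he t ht).1.continuousAt.continuousWithinAt)
      (fun t ht => (he t (interior_subset ht)).1.hasDerivWithinAt)
      fun t ht => (he t (interior_subset ht)).2.trans (neg_nonpos.2 (hD0 t))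
  -- `R_le_of_le` requires `η ≤ 2 / 9` and loses a factor `3`. With `a ≤ η / 2` and `D ≤ δ = η² / (4
  -- J)`, `R_sq_le` gives `R² ≤ η² / 2 + η² / 2`.
  set η := min (ε / 3) (2 / 9) with hη
  have hηpos : 0 < η := by positivity
  set δ := η ^ 2 / (4 * J) with hδ
  have hδpos : 0 < δ := by positivity
  have hbdd : BddBelow (F '' Ici T₀) := ⟨0, by rintro _ ⟨t, -, rfl⟩; exact hF0 t⟩
  -- After `T` the function `F` drops by less than `δ` in total, so by the mean value theorem each
  -- later unit interval contains a time with `D ≤ δ`.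
  obtain ⟨_, ⟨T, hT, rfl⟩, hTlt⟩ := Real.lt_sInf_add_pos
    (s := F '' Ici T₀) ⟨F T₀, T₀, mem_Ici.2 le_rfl, rfl⟩ hδpos
  rw [mem_Ici] at hT
  -- The last summand leaves room for the window `[t - 1, t]`; the middle one makes `a ≤ C / s ≤ η /
  -- 2` in that window.
  refine ⟨T + 2 * C / η + 1, fun t ht x hx => ?_⟩
  have hq : 0 < 2 * C / η := by positivity
  have hs0 : T ≤ t - 1 := by linarith
  have hFlt : F (t - 1) - F t < δ := by
    have h1 : F (t - 1) ≤ F T := hanti (mem_Ici.2 hT) (mem_Ici.2 (hT.trans hs0)) hs0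
    have h2 : sInf (F '' Ici T₀) ≤ F t :=
      csInf_le hbdd ⟨t, mem_Ici.2 (by linarith), rfl⟩
    linarith
  choose! e he using hFd
  obtain ⟨s, hs, hs'⟩ := exists_hasDerivAt_eq_slope F e (show t - 1 < t by linarith)
    (fun s hs => (he s (by linarith [hs.1])).1.continuousAt.continuousWithinAt)
    (fun s hs => (he s (by linarith [hs.1])).1)
  rw [show t - (t - 1) = 1 by ring, div_one] at hs'
  have hDs : D s ≤ δ := by linarith [(he s (by linarith [hs.1])).2]
  have hspos : 0 < s := by linarith [hs.1]
  have has : a s ≤ η / 2 := by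
    refine (hCa s hspos).trans ?_
    rw [div_le_iff₀ hspos]
    have : 2 * C / η ≤ s := by linarith [hs.1]
    rw [div_le_iff₀ hηpos] at this
    linarith
  have hRs : ∀ y ∈ Icc (-ρ) ρ, R (s, y) ≤ η := by
    intro y hy
    have h1 := h.R_sq_le hspos hy
    have h2 : a s ^ 2 ≤ (η / 2) ^ 2 := pow_le_pow_left₀ (h.avg_nonneg hspos.le) has 2
    have h3 : J * D s ≤ J * δ := mul_le_mul_of_nonneg_left hDs hJ.le
    have h4 : J * δ = η ^ 2 / 4 := by
      rw [hδ]
      field_simp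
    refine le_of_sq_le_sq ?_ hηpos.le
    change R (s, y) ^ 2 ≤ 2 * a s ^ 2 + 2 * (J * D s) at h1
    linarith
  have := h.R_le_of_le hspos hηpos (min_le_right _ _) hRs (t := t)
    ⟨hs.2.le, by linarith [hs.1]⟩ hx
  linarith [min_le_left (ε / 3) (2 / 9)]

end CylFlow
end Cylinder

/-! ### Curvature of the metrics `exp w * (dθ² + dr² / f²)` -/

namespace Cylinder

variable {ρ : ℝ} {f : ℝ → ℝ}

theorem uniqueDiffOn_band (hρ : 0 < ρ) : UniqueDiffOn ℝ (band ρ) := by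
  have h : band ρ = (ContinuousLinearMap.proj (R := ℝ) (φ := fun _ : Fin 2 => ℝ) 1) ⁻¹' Icc (-ρ) ρ := rfl
  refine uniqueDiffOn_convex ?_ ⟨0, ?_⟩
  · rw [h]
    exact (convex_Icc _ _).linear_preimage
      (ContinuousLinearMap.proj (R := ℝ) (φ := fun _ : Fin 2 => ℝ) 1).toLinearMap
  · refine mem_interior_iff_mem_nhds.2 ?_
    have hc : Continuous fun p : Pt => p 1 := continuous_apply 1
    exact hc.continuousAt (Icc_mem_nhds (by simpa using hρ) (by simpa using hρ))

theorem mem_band {θ r : ℝ} : (![θ, r] : Pt) ∈ band ρ ↔ r ∈ Icc (-ρ) ρ := Iff.rfl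

theorem eq_vec (p : Pt) : ![p 0, p 1] = p := by
  ext i
  fin_cases i <;> rfl

theorem contDiffOn_pd (hρ : 0 < ρ) (i : Fin 2) {u : Pt → ℝ} (hu : ContDiffOn ℝ ∞ u (band ρ)) :
    ContDiffOn ℝ ∞ (pd ρ i u) (band ρ) := contDiffOn_dirDeriv (uniqueDiffOn_band hρ) _ hu

theorem pd_congr {i : Fin 2} {u v : Pt → ℝ} (h : EqOn u v (band ρ)) {p : Pt} (hp : p ∈ band ρ) :
    pd ρ i u p = pd ρ i v p := dirDeriv_congr h hp

theorem hasDerivWithinAt_pd_one {u : Pt → ℝ} (hu : ContDiffOn ℝ ∞ u (band ρ)) {θ r : ℝ}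
    (hr : r ∈ Icc (-ρ) ρ) :
    HasDerivWithinAt (fun s => u ![θ, s]) (pd ρ 1 u ![θ, r]) (Icc (-ρ) ρ) r := by
  refine hasDerivWithinAt_line hu (v := Pi.single 1 1) (γ := fun s => ![θ, s]) ?_
    (fun s hs => mem_band.2 hs) hr
  rw [hasDerivWithinAt_pi]
  intro i
  fin_cases i
  · exact (hasDerivAt_const r θ).hasDerivWithinAt
  · exact (hasDerivAt_id r).hasDerivWithinAt

theorem hasDerivAt_pd_zero {u : Pt → ℝ} (hu : ContDiffOn ℝ ∞ u (band ρ)) {θ r : ℝ}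
    (hr : r ∈ Icc (-ρ) ρ) :
    HasDerivAt (fun s => u ![s, r]) (pd ρ 0 u ![θ, r]) θ := by
  rw [← hasDerivWithinAt_univ]
  refine hasDerivWithinAt_line hu (v := Pi.single 0 1) (γ := fun s => ![s, r]) ?_
    (fun s _ => mem_band.2 hr) (mem_univ θ)
  rw [hasDerivWithinAt_pi]
  intro i
  fin_cases i
  · exact (hasDerivAt_id θ).hasDerivWithinAt
  · exact (hasDerivAt_const θ r).hasDerivWithinAt

theorem pd_one_eq (hρ : 0 < ρ) {u : Pt → ℝ} (hu : ContDiffOn ℝ ∞ u (band ρ)) {θ r d : ℝ}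
    (hr : r ∈ Icc (-ρ) ρ) (hd : HasDerivWithinAt (fun s => u ![θ, s]) d (Icc (-ρ) ρ) r) :
    pd ρ 1 u ![θ, r] = d :=
  (uniqueDiffOn_Icc (by linarith) r hr).eq_deriv _ (hasDerivWithinAt_pd_one hu hr) hd

theorem pd_zero_eq {u : Pt → ℝ} (hu : ContDiffOn ℝ ∞ u (band ρ)) {θ r d : ℝ}
    (hr : r ∈ Icc (-ρ) ρ) (hd : HasDerivAt (fun s => u ![s, r]) d θ) :
    pd ρ 0 u ![θ, r] = d :=
  (hasDerivAt_pd_zero hu hr).unique hd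

/-- The metric `exp w * (dθ² + dr² / f²)`. -/
noncomputable def isoMetric (f : ℝ → ℝ) (w : Pt → ℝ) : Field2 := fun p =>
  !![Real.exp (w p), 0; 0, Real.exp (w p) / f (p 1) ^ 2]

theorem inv_diag {x y : ℝ} (hx : x ≠ 0) (hy : y ≠ 0) :
    (!![x, 0; 0, y] : Matrix (Fin 2) (Fin 2) ℝ)⁻¹ = !![x⁻¹, 0; 0, y⁻¹] := by
  apply Matrix.inv_eq_right_inv
  ext i j
  fin_cases i <;> fin_cases j <;> simp [Matrix.mul_apply, hx, hy]

/-- Smooth data on the cylinder: the profile `f` and the logarithm `w` of the conformal factor. -/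
structure IsoData (ρ : ℝ) (f : ℝ → ℝ) (w : Pt → ℝ) : Prop where
  hρ : 0 < ρ
  f_smooth : ContDiffOn ℝ ∞ f (Icc (-ρ) ρ)
  f_pos : ∀ r ∈ Icc (-ρ) ρ, 0 < f r
  w_smooth : ContDiffOn ℝ ∞ w (band ρ)

namespace IsoData

variable {w : Pt → ℝ}

theorem f_smooth' (h : IsoData ρ f w) : ContDiffOn ℝ ∞ (fun p : Pt => f (p 1)) (band ρ) :=
  h.f_smooth.comp (contDiff_apply ℝ ℝ 1).contDiffOn fun _ hp => hp

theorem hasDeriv_f (h : IsoData ρ f w) {r : ℝ} (hr : r ∈ Icc (-ρ) ρ) :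
    HasDerivWithinAt f (derivWithin f (Icc (-ρ) ρ) r) (Icc (-ρ) ρ) r :=
  (h.f_smooth.differentiableOn (by simp) r hr).hasDerivWithinAt

theorem flux_smooth (h : IsoData ρ f w) :
    ContDiffOn ℝ ∞ (fun q => f (q 1) * pd ρ 1 w q) (band ρ) :=
  h.f_smooth'.mul (contDiffOn_pd h.hρ 1 h.w_smooth)

variable {g : Field2}

theorem inv_eq (h : IsoData ρ f w) (hg : EqOn g (isoMetric f w) (band ρ)) {θ r : ℝ}
    (hr : r ∈ Icc (-ρ) ρ) : (g ![θ, r])⁻¹ =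
      !![(Real.exp (w ![θ, r]))⁻¹, 0; 0, (Real.exp (w ![θ, r]) / f r ^ 2)⁻¹] := by
  rw [hg (mem_band.2 hr)]
  have := h.f_pos r hr
  exact inv_diag (Real.exp_pos _).ne' (div_pos (Real.exp_pos _) (by positivity)).ne'

theorem pd_offdiag (hg : EqOn g (isoMetric f w) (band ρ)) {θ r : ℝ}
    (hr : r ∈ Icc (-ρ) ρ) (i j k : Fin 2) (hjk : j ≠ k) :
    pd ρ i (fun q => g q j k) ![θ, r] = 0 := by
  have h1 : EqOn (fun q => g q j k) (fun _ => 0) (band ρ) := by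
    intro q hq
    simp only [hg hq, isoMetric]
    fin_cases j <;> fin_cases k <;> simp_all
  rw [pd_congr h1 (mem_band.2 hr), pd]
  simp

theorem pd_metric_zero_zero (h : IsoData ρ f w) (hg : EqOn g (isoMetric f w) (band ρ)) {θ r : ℝ}
    (hr : r ∈ Icc (-ρ) ρ) (i : Fin 2) :
    pd ρ i (fun q => g q 0 0) ![θ, r] = Real.exp (w ![θ, r]) * pd ρ i w ![θ, r] := by
  have h1 : EqOn (fun q => g q 0 0) (fun q => Real.exp (w q)) (band ρ) := by
    intro q hq
    simp [hg hq, isoMetric]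
  rw [pd_congr h1 (mem_band.2 hr)]
  fin_cases i
  · exact pd_zero_eq h.w_smooth.exp hr (hasDerivAt_pd_zero h.w_smooth hr).exp
  · exact pd_one_eq h.hρ h.w_smooth.exp hr (hasDerivWithinAt_pd_one h.w_smooth hr).exp

theorem metric_one_one_smooth (h : IsoData ρ f w) :
    ContDiffOn ℝ ∞ (fun q => Real.exp (w q) / f (q 1) ^ 2) (band ρ) :=
  h.w_smooth.exp.div (h.f_smooth'.pow 2) fun q hq => pow_ne_zero 2 (h.f_pos (q 1) hq).ne'

theorem metric_one_one_congr (hg : EqOn g (isoMetric f w) (band ρ)) :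
    EqOn (fun q => g q 1 1) (fun q => Real.exp (w q) / f (q 1) ^ 2) (band ρ) := by
  intro q hq
  simp [hg hq, isoMetric]

theorem pd_zero_metric_one_one (h : IsoData ρ f w) (hg : EqOn g (isoMetric f w) (band ρ)) {θ r : ℝ}
    (hr : r ∈ Icc (-ρ) ρ) :
    pd ρ 0 (fun q => g q 1 1) ![θ, r]
      = Real.exp (w ![θ, r]) / f r ^ 2 * pd ρ 0 w ![θ, r] := by
  rw [pd_congr (metric_one_one_congr hg) (mem_band.2 hr)]
  refine pd_zero_eq h.metric_one_one_smooth hr ?_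
  refine ((hasDerivAt_pd_zero h.w_smooth hr).exp.div_const (f r ^ 2)).congr_deriv ?_
  ring

theorem pd_one_metric_one_one (h : IsoData ρ f w) (hg : EqOn g (isoMetric f w) (band ρ)) {θ r : ℝ}
    (hr : r ∈ Icc (-ρ) ρ) :
    pd ρ 1 (fun q => g q 1 1) ![θ, r] = Real.exp (w ![θ, r]) / f r ^ 2 *
      (pd ρ 1 w ![θ, r] - 2 * derivWithin f (Icc (-ρ) ρ) r / f r) := by
  rw [pd_congr (metric_one_one_congr hg) (mem_band.2 hr)]
  refine pd_one_eq h.hρ h.metric_one_one_smooth hr ?_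
  have hf := h.f_pos r hr
  refine ((hasDerivWithinAt_pd_one h.w_smooth hr).exp.div ((h.hasDeriv_f hr).pow 2)
    (pow_ne_zero 2 hf.ne')).congr_deriv ?_
  simp only [Pi.pow_apply]
  field_simp
  ring

/-- The Christoffel symbols. -/
theorem christoffel_eq (h : IsoData ρ f w) (hg : EqOn g (isoMetric f w) (band ρ)) {θ r : ℝ}
    (hr : r ∈ Icc (-ρ) ρ) :
    christoffel ρ g 0 0 0 ![θ, r] = pd ρ 0 w ![θ, r] / 2 ∧
    christoffel ρ g 0 0 1 ![θ, r] = pd ρ 1 w ![θ, r] / 2 ∧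
    christoffel ρ g 0 1 0 ![θ, r] = pd ρ 1 w ![θ, r] / 2 ∧
    christoffel ρ g 0 1 1 ![θ, r] = -pd ρ 0 w ![θ, r] / (2 * f r ^ 2) ∧
    christoffel ρ g 1 0 0 ![θ, r] = -(f r * (f r * pd ρ 1 w ![θ, r])) / 2 ∧
    christoffel ρ g 1 0 1 ![θ, r] = pd ρ 0 w ![θ, r] / 2 ∧
    christoffel ρ g 1 1 0 ![θ, r] = pd ρ 0 w ![θ, r] / 2 ∧
    christoffel ρ g 1 1 1 ![θ, r]
      = pd ρ 1 w ![θ, r] / 2 - derivWithin f (Icc (-ρ) ρ) r / f r := by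
  have hf := (h.f_pos r hr).ne'
  have he := (Real.exp_pos (w ![θ, r])).ne'
  have h01 : ∀ i, pd ρ i (fun q => g q 0 1) ![θ, r] = 0 := fun i =>
    pd_offdiag hg hr i 0 1 (by decide)
  have h10 : ∀ i, pd ρ i (fun q => g q 1 0) ![θ, r] = 0 := fun i =>
    pd_offdiag hg hr i 1 0 (by decide)
  have h00 := h.pd_metric_zero_zero hg (θ := θ) hr
  have h011 := h.pd_zero_metric_one_one hg (θ := θ) hr
  have h111 := h.pd_one_metric_one_one hg (θ := θ) hr
  refine ⟨?_, ?_, ?_, ?_, ?_, ?_, ?_, ?_⟩ <;>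
  · simp only [christoffel, h.inv_eq hg hr, Fin.sum_univ_two, h01, h10, h00, h011, h111]
    simp
    field_simp
    try ring

/-- The scalar curvature in conformal coordinates. -/
theorem scalarCurv_eq (h : IsoData ρ f w) (hg : EqOn g (isoMetric f w) (band ρ)) {θ r : ℝ}
    (hr : r ∈ Icc (-ρ) ρ) : scalarCurv ρ g ![θ, r] = -(Real.exp (w ![θ, r]))⁻¹ *
      (pd ρ 0 (pd ρ 0 w) ![θ, r] + f r * pd ρ 1 (fun q => f (q 1) * pd ρ 1 w q) ![θ, r]) := by
  have hρ := h.hρ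
  have hf := (h.f_pos r hr).ne'
  have he := (Real.exp_pos (w ![θ, r])).ne'
  have hmem : (![θ, r] : Pt) ∈ band ρ := hr
  have hw0 := contDiffOn_pd hρ 0 h.w_smooth
  have hP := h.flux_smooth
  have hf2 : ∀ q ∈ band ρ, f (q 1) ≠ 0 := fun q hq => (h.f_pos (q 1) hq).ne'
  have hΓ := fun (q : Pt) (hq : q ∈ band ρ) => by
    have := h.christoffel_eq hg (θ := q 0) (r := q 1) hq
    rwa [eq_vec] at this
  obtain ⟨e000, e001, e010, e011, e100, e101, e110, e111⟩ := h.christoffel_eq hg (θ := θ) hr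
  -- The inverse metric is diagonal and the components with equal first two indices `i = j` vanish,
  -- so only `R¹₁₀₀` and `R⁰₀₁₁` matter; they involve these four derivatives.
  have d100 : pd ρ 1 (christoffel ρ g 1 0 0) ![θ, r]
      = -(derivWithin f (Icc (-ρ) ρ) r * (f r * pd ρ 1 w ![θ, r])
        + f r * pd ρ 1 (fun q => f (q 1) * pd ρ 1 w q) ![θ, r]) / 2 := by
    rw [pd_congr (v := fun q => -(f (q 1) * (f (q 1) * pd ρ 1 w q)) / 2)
      (fun q hq => (hΓ q hq).2.2.2.2.1) hmem]
    refine pd_one_eq hρ ((h.f_smooth'.mul hP).neg.div_const 2) hr ?_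
    exact (((h.hasDeriv_f hr).mul (hasDerivWithinAt_pd_one hP hr)).neg).div_const 2
  have d110 : pd ρ 0 (christoffel ρ g 1 1 0) ![θ, r] = pd ρ 0 (pd ρ 0 w) ![θ, r] / 2 := by
    rw [pd_congr (v := fun q => pd ρ 0 w q / 2) (fun q hq => (hΓ q hq).2.2.2.2.2.2.1) hmem]
    exact pd_zero_eq (hw0.div_const 2) hr ((hasDerivAt_pd_zero hw0 hr).div_const 2)
  have d011 : pd ρ 0 (christoffel ρ g 0 1 1) ![θ, r]
      = -pd ρ 0 (pd ρ 0 w) ![θ, r] / (2 * f r ^ 2) := by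
    rw [pd_congr (v := fun q => -pd ρ 0 w q / (2 * f (q 1) ^ 2))
      (fun q hq => (hΓ q hq).2.2.2.1) hmem]
    refine pd_zero_eq (hw0.neg.div (contDiffOn_const.mul (h.f_smooth'.pow 2))
      fun q hq => mul_ne_zero two_ne_zero (pow_ne_zero 2 (hf2 q hq))) hr ?_
    exact (hasDerivAt_pd_zero hw0 hr).neg.div_const (2 * f r ^ 2)
  have d001 : pd ρ 1 (christoffel ρ g 0 0 1) ![θ, r]
      = (pd ρ 1 (fun q => f (q 1) * pd ρ 1 w q) ![θ, r] * f r
        - f r * pd ρ 1 w ![θ, r] * derivWithin f (Icc (-ρ) ρ) r) / f r ^ 2 / 2 := by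
    -- Writing `∂ᵣ w` as flux over `f` lets only the derivative of the flux appear; the terms in
    -- `f'` then cancel.
    rw [pd_congr (v := fun q => (f (q 1) * pd ρ 1 w q) / f (q 1) / 2)
      (fun q hq => by
        rw [(hΓ q hq).2.1]
        have := hf2 q hq
        field_simp) hmem]
    refine pd_one_eq hρ ((hP.div h.f_smooth' hf2).div_const 2) hr ?_
    exact ((hasDerivWithinAt_pd_one hP hr).div (h.hasDeriv_f hr) hf).div_const 2
  simp only [scalarCurv, ricci, riemann, Fin.sum_univ_two, h.inv_eq hg hr]
  simp only [d100, d110, d011, d001, e000, e001, e010, e011, e100, e101, e110, e111]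
  simp
  field_simp
  ring

/-- The geodesic curvature of the boundary in conformal coordinates. -/
theorem geodCurv_eq (h : IsoData ρ f w) (hg : EqOn g (isoMetric f w) (band ρ)) {θ r : ℝ}
    (hr : r ∈ Icc (-ρ) ρ) : geodCurv ρ g ![θ, r]
      = Real.sign r * (f r * pd ρ 1 w ![θ, r]) / (2 * Real.exp (w ![θ, r] / 2)) := by
  have hf := h.f_pos r hr
  have hexp : Real.exp (w ![θ, r]) = Real.exp (w ![θ, r] / 2) ^ 2 := by
    rw [← Real.exp_nat_mul]
    congr 1
    push_cast
    ring
  obtain ⟨e000, e001, e010, e011, e100, e101, e110, e111⟩ := h.christoffel_eq hg (θ := θ) hr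
  have hsq : √((Real.exp (w ![θ, r]) / f r ^ 2)⁻¹) = f r / Real.exp (w ![θ, r] / 2) := by
    rw [hexp, ← div_pow, ← inv_pow, Real.sqrt_sq (by positivity), inv_div]
  simp only [geodCurv, outwardNormal, Fin.sum_univ_two, h.inv_eq hg hr, e000, e100]
  simp only [hg (mem_band.2 hr), isoMetric]
  simp only [Matrix.cons_val', Matrix.cons_val_zero, Matrix.cons_val_one, Matrix.of_apply,
    Matrix.cons_val_fin_one]
  rw [hsq, hexp]
  have := Real.exp_pos (w ![θ, r] / 2)
  field_simp
  try ring

end IsoData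
end Cylinder

/-! ### Preservation of rotational symmetry and reduction to the radial flow -/

namespace Cylinder

variable {ρ : ℝ} {f : ℝ → ℝ} {g : ℝ → Field2}

theorem contDiff_vec {E : Type*} [NormedAddCommGroup E] [NormedSpace ℝ E] {x y : E → ℝ}
    (hx : ContDiff ℝ ∞ x) (hy : ContDiff ℝ ∞ y) : ContDiff ℝ ∞ (fun e => (![x e, y e] : Pt)) := by
  refine contDiff_pi.2 fun i => ?_
  fin_cases i
  · exact hx
  · exact hy

theorem continuousOn_comp_pair {X : Type*} [TopologicalSpace X] (F : ℝ → Pt → ℝ)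
    (hF : ContinuousOn (fun q : ℝ × Pt => F q.1 q.2) (Ici 0 ×ˢ band ρ)) {τ : X → ℝ} {γ : X → Pt}
    (hτ : Continuous τ) (hγ : Continuous γ) {S : Set X} (hm : ∀ x ∈ S, 0 ≤ τ x ∧ γ x ∈ band ρ) :
    ContinuousOn (fun x => F (τ x) (γ x)) S :=
  hF.comp (f := fun x => (τ x, γ x)) (hτ.prodMk hγ).continuousOn fun x hx => hm x hx

/-- The logarithm of the conformal factor of `g` with respect to `dθ² + dr² / f²`. -/
noncomputable def logFactor (g : ℝ → Field2) (t : ℝ) (p : Pt) : ℝ := Real.log (g t p 0 0)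

namespace IsNormalisedRicciFlow

variable {g₀ : Field2}

theorem component_pos (hg : IsNormalisedRicciFlow ρ g₀ g) {t : ℝ} (ht : 0 ≤ t) {p : Pt}
    (hp : p ∈ band ρ) : 0 < g t p 0 0 := ((hg.metric t ht).posDef p hp).diag_pos

theorem exp_logFactor (hg : IsNormalisedRicciFlow ρ g₀ g) {t : ℝ} (ht : 0 ≤ t) {p : Pt}
    (hp : p ∈ band ρ) : Real.exp (logFactor g t p) = g t p 0 0 :=
  Real.exp_log (hg.component_pos ht hp)

/-- At each point all components solve the same linear scalar equation, so their ratios are constant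
in time: the conformal class is fixed. -/
theorem quotient_eq (hg : IsNormalisedRicciFlow ρ g₀ g) {t : ℝ} (ht : 0 ≤ t) {p : Pt}
    (hp : p ∈ band ρ) (i j : Fin 2) : g t p i j / g t p 0 0 = g₀ p i j / g₀ p 0 0 := by
  have hc : ∀ i j, ContinuousOn (fun s => g s p i j) (Ici 0) := fun i j =>
    (hg.continuous i j).comp (f := fun s : ℝ => (s, p)) (by fun_prop) fun s hs => ⟨hs, hp⟩
  rw [← hg.initial p hp]
  refine eq_of_hasDerivAt_zero (u := fun t => g t p i j / g t p 0 0) ((hc i j).div (hc 0 0)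
    fun s hs => (hg.component_pos hs hp).ne') (fun s hs => ?_) ht
  refine ((hg.evolution s hs p hp i j).div (hg.evolution s hs p hp 0 0)
    (hg.component_pos hs.le hp).ne').congr_deriv ?_
  rw [div_eq_zero_iff]
  left
  ring

theorem logFactor_smooth (hg : IsNormalisedRicciFlow ρ g₀ g) {t : ℝ} (ht : 0 ≤ t) :
    ContDiffOn ℝ ∞ (logFactor g t) (band ρ) :=
  ((hg.metric t ht).smooth 0 0).log fun _ hp => (hg.component_pos ht hp).ne'

theorem logFactor_smooth_joint (hg : IsNormalisedRicciFlow ρ g₀ g) :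
    ContDiffOn ℝ ∞ (fun q : ℝ × Pt => logFactor g q.1 q.2) (Ioi 0 ×ˢ band ρ) :=
  (hg.smooth 0 0).log fun _ hq => (hg.component_pos (mem_Ioi.1 hq.1).le hq.2).ne'

theorem logFactor_continuous (hg : IsNormalisedRicciFlow ρ g₀ g) :
    ContinuousOn (fun q : ℝ × Pt => logFactor g q.1 q.2) (Ici 0 ×ˢ band ρ) :=
  (hg.continuous 0 0).log fun _ hq => (hg.component_pos hq.1 hq.2).ne'

theorem logFactor_periodic (hg : IsNormalisedRicciFlow ρ g₀ g) {t : ℝ} (ht : 0 ≤ t) (θ : ℝ) {r : ℝ}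
    (hr : r ∈ Icc (-ρ) ρ) : logFactor g t ![θ + 2 * Real.pi, r] = logFactor g t ![θ, r] := by
  rw [logFactor, logFactor, (hg.metric t ht).periodic θ r hr]

theorem hasDerivAt_logFactor (hg : IsNormalisedRicciFlow ρ g₀ g) {t : ℝ} (ht : 0 < t) {p : Pt}
    (hp : p ∈ band ρ) :
    HasDerivAt (fun s => logFactor g s p) (avgCurv ρ (g t) - scalarCurv ρ (g t) p) t := by
  have h := hg.component_pos ht.le hp
  refine ((hg.evolution t ht p hp 0 0).log h.ne').congr_deriv ?_
  field_simp

end IsNormalisedRicciFlow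

/-- A normalised Ricci flow that starts at a rotationally symmetric metric with boundary of
non-positive geodesic curvature. -/
structure RotFlow (ρ : ℝ) (f : ℝ → ℝ) (g : ℝ → Field2) : Prop where
  hρ : 0 < ρ
  f_smooth : ContDiffOn ℝ ∞ f (Icc (-ρ) ρ)
  f_pos : ∀ r ∈ Icc (-ρ) ρ, 0 < f r
  geod : ∀ p ∈ bdry ρ, geodCurv ρ (rotMetric f) p ≤ 0
  flow : IsNormalisedRicciFlow ρ (rotMetric f) g

namespace RotFlow

theorem isoData (h : RotFlow ρ f g) {t : ℝ} (ht : 0 ≤ t) : IsoData ρ f (logFactor g t) :=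
  ⟨h.hρ, h.f_smooth, h.f_pos, h.flow.logFactor_smooth ht⟩

theorem eqOn_isoMetric (h : RotFlow ρ f g) {t : ℝ} (ht : 0 ≤ t) :
    EqOn (g t) (isoMetric f (logFactor g t)) (band ρ) := by
  intro p hp
  have hfp := h.f_pos (p 1) hp
  have hpos := h.flow.component_pos ht hp
  have hq := h.flow.quotient_eq ht hp
  have h01 := hq 0 1
  have h10 := hq 1 0
  have h11 := hq 1 1
  simp only [rotMetric] at h01 h10 h11
  simp at h01 h10 h11
  ext i j
  fin_cases i <;> fin_cases j <;>
    simp [isoMetric, h.flow.exp_logFactor ht hp]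
  · exact h01.resolve_right hpos.ne'
  · exact h10.resolve_right hpos.ne'
  · rw [div_eq_iff hpos.ne'] at h11
    rw [h11]
    field_simp

theorem rotMetric_eqOn_isoMetric (h : RotFlow ρ f g) :
    EqOn (rotMetric f) (isoMetric f (logFactor g 0)) (band ρ) := fun p hp => by
  rw [← h.eqOn_isoMetric le_rfl hp, h.flow.initial p hp]

theorem logFactor_zero (h : RotFlow ρ f g) {p : Pt} (hp : p ∈ band ρ) :
    logFactor g 0 p = Real.log (f (p 1) ^ 2) := by
  rw [logFactor, h.flow.initial p hp]
  simp [rotMetric]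

theorem right_mem (h : RotFlow ρ f g) : ρ ∈ Icc (-ρ) ρ := right_mem_Icc.2 (by linarith [h.hρ])

theorem left_mem (h : RotFlow ρ f g) : -ρ ∈ Icc (-ρ) ρ := left_mem_Icc.2 (by linarith [h.hρ])

theorem scalarCurv_eq (h : RotFlow ρ f g) {t : ℝ} (ht : 0 ≤ t) (θ : ℝ) {r : ℝ}
    (hr : r ∈ Icc (-ρ) ρ) : scalarCurv ρ (g t) ![θ, r]
      = -(Real.exp (logFactor g t ![θ, r]))⁻¹ * (pd ρ 0 (pd ρ 0 (logFactor g t)) ![θ, r]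
        + f r * pd ρ 1 (fun q => f (q 1) * pd ρ 1 (logFactor g t) q) ![θ, r]) :=
  (h.isoData ht).scalarCurv_eq (h.eqOn_isoMetric ht) hr

theorem pd_one_eq_of_indep (hρ : 0 < ρ) {u : Pt → ℝ} (hu : ContDiffOn ℝ ∞ u (band ρ))
    (hind : ∀ θ, ∀ r ∈ Icc (-ρ) ρ, u ![θ, r] = u ![0, r]) (θ : ℝ) {r : ℝ} (hr : r ∈ Icc (-ρ) ρ) :
    pd ρ 1 u ![θ, r] = pd ρ 1 u ![0, r] :=
  pd_one_eq hρ hu hr ((hasDerivWithinAt_pd_one hu hr).congr (fun s hs => hind θ s hs) (hind θ r hr))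

theorem geodCurv_rotMetric (h : RotFlow ρ f g) (θ : ℝ) {r : ℝ} (hr : r ∈ Icc (-ρ) ρ) :
    geodCurv ρ (rotMetric f) ![θ, r] = geodCurv ρ (rotMetric f) ![0, r] := by
  have hI := h.isoData le_rfl
  have hind : ∀ θ, ∀ r ∈ Icc (-ρ) ρ, logFactor g 0 ![θ, r] = logFactor g 0 ![0, r] :=
    fun θ r hr => by
      rw [h.logFactor_zero (mem_band.2 hr), h.logFactor_zero (mem_band.2 hr)]
      rfl
  rw [hI.geodCurv_eq h.rotMetric_eqOn_isoMetric hr, hI.geodCurv_eq h.rotMetric_eqOn_isoMetric hr,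
    pd_one_eq_of_indep h.hρ hI.w_smooth hind θ hr, hind θ r hr]

theorem sqrt_normFactor (t : ℝ) :
    √(normFactor ρ g t) = Real.exp ((∫ s in (0 : ℝ)..t, avgCurv ρ (g s)) / 2) := by
  rw [normFactor, ← Real.exp_half]

theorem bdry_right (h : RotFlow ρ f g) {t : ℝ} (ht : 0 < t) (θ : ℝ) :
    f ρ * pd ρ 1 (logFactor g t) ![θ, ρ] = 2 * (geodCurv ρ (rotMetric f) ![0, ρ]
      / Real.exp ((∫ s in (0 : ℝ)..t, avgCurv ρ (g s)) / 2))
      * Real.exp (logFactor g t ![θ, ρ] / 2) := by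
  have h1 := h.flow.boundary t ht ![θ, ρ] (Or.inr rfl)
  rw [(h.isoData ht.le).geodCurv_eq (h.eqOn_isoMetric ht.le) h.right_mem,
    h.geodCurv_rotMetric θ h.right_mem, sqrt_normFactor, Real.sign_of_pos h.hρ,
    div_eq_iff (by positivity)] at h1
  linear_combination h1

theorem bdry_left (h : RotFlow ρ f g) {t : ℝ} (ht : 0 < t) (θ : ℝ) :
    f (-ρ) * pd ρ 1 (logFactor g t) ![θ, -ρ] = -2 * (geodCurv ρ (rotMetric f) ![0, -ρ]
      / Real.exp ((∫ s in (0 : ℝ)..t, avgCurv ρ (g s)) / 2))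
      * Real.exp (logFactor g t ![θ, -ρ] / 2) := by
  have h1 := h.flow.boundary t ht ![θ, -ρ] (Or.inl rfl)
  rw [(h.isoData ht.le).geodCurv_eq (h.eqOn_isoMetric ht.le) h.left_mem,
    h.geodCurv_rotMetric θ h.left_mem, sqrt_normFactor,
    Real.sign_of_neg (neg_lt_zero.2 h.hρ), div_eq_iff (by positivity)] at h1
  linear_combination -h1

theorem one_sub_exp_neg_bounds {d : ℝ} (hd : 0 < d) :
    0 ≤ 1 - Real.exp (-d) ∧ 1 - Real.exp (-d) ≤ d :=
  ⟨sub_nonneg.2 (Real.exp_le_one_iff.2 (by linarith)), by linarith [Real.add_one_le_exp (-d)]⟩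

/-- The reaction term in the equation for the difference of two solutions at a positive maximum. -/
theorem scalarCurv_sub_le_of_max (h : RotFlow ρ f g) (α : ℝ) {s : ℝ} (hs0 : 0 < s) {w : Pt → ℝ}
    (hw : w = logFactor g s) {x y B : ℝ} (hy : y ∈ Icc (-ρ) ρ)
    (hmax : ∀ x', ∀ y' ∈ Icc (-ρ) ρ, w ![x' + α, y'] - w ![x', y'] ≤ w ![x + α, y] - w ![x, y])
    (hpos : 0 < w ![x + α, y] - w ![x, y]) (hB : |scalarCurv ρ (g s) ![x, y]| ≤ B) :
    scalarCurv ρ (g s) ![x, y] - scalarCurv ρ (g s) ![x + α, y]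
      ≤ B * (w ![x + α, y] - w ![x, y]) := by
  have hI : IsoData ρ f w := hw ▸ h.isoData hs0.le
  have hbr := h.bdry_right hs0
  have hbl := h.bdry_left hs0
  rw [← hw] at hbr hbl
  have hw0 := contDiffOn_pd h.hρ 0 hI.w_smooth
  have hP := hI.flux_smooth
  -- There is no boundary in the `θ` direction: `x` is interior to the test interval, and both
  -- endpoint cases are void.
  have hlap0 : pd ρ 0 (pd ρ 0 w) ![x + α, y] - pd ρ 0 (pd ρ 0 w) ![x, y] ≤ 0 := by
    refine deriv_flux_nonpos_of_max (a := x - 1) (b := x + 1) (x := x) (m := fun _ => 1)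
      (u := fun x' => w ![x' + α, y] - w ![x', y])
      (q := fun x' => pd ρ 0 w ![x' + α, y] - pd ρ 0 w ![x', y]) (by linarith)
      ⟨by linarith, by linarith⟩ (fun x' _ => ?_) (fun _ _ => one_pos)
      (fun x' _ => hmax x' y hy) (fun h => by linarith) (fun h => by linarith) ?_
    · rw [one_mul]
      exact (((hasDerivAt_pd_zero hI.w_smooth hy).comp_add_const x' α).sub
        (hasDerivAt_pd_zero hI.w_smooth hy)).hasDerivWithinAt
    · exact (((hasDerivAt_pd_zero hw0 hy).comp_add_const x α).sub
        (hasDerivAt_pd_zero hw0 hy)).hasDerivWithinAt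
  have hlap1 : pd ρ 1 (fun q => f (q 1) * pd ρ 1 w q) ![x + α, y]
      - pd ρ 1 (fun q => f (q 1) * pd ρ 1 w q) ![x, y] ≤ 0 := by
    -- The boundary fluxes differ by a multiple of this difference of exponentials; `k_{g₀} ≤ 0`
    -- then gives the sign that the endpoint test needs.
    have hexp : Real.exp (w ![x, y] / 2) ≤ Real.exp (w ![x + α, y] / 2) :=
      Real.exp_le_exp.2 (by linarith)
    refine deriv_flux_nonpos_of_max (a := -ρ) (b := ρ) (x := y) (m := fun y' => 1 / f y')
      (u := fun y' => w ![x + α, y'] - w ![x, y'])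
      (q := fun y' => f y' * pd ρ 1 w ![x + α, y'] - f y' * pd ρ 1 w ![x, y'])
      (by linarith [h.hρ]) hy (fun y' hy' => ?_)
      (fun y' hy' => one_div_pos.2 (h.f_pos y' hy')) (fun y' hy' => hmax x y' hy')
      ?_ ?_ ?_
    · refine ((hasDerivWithinAt_pd_one hI.w_smooth hy').sub
        (hasDerivWithinAt_pd_one hI.w_smooth hy')).congr_deriv ?_
      have := (h.f_pos y' hy').ne'
      field_simp
    · rintro rfl
      rw [hbr, hbr, ← mul_sub]
      refine mul_nonpos_of_nonpos_of_nonneg ?_ (sub_nonneg.2 hexp)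
      exact mul_nonpos_of_nonneg_of_nonpos zero_le_two
        (div_nonpos_of_nonpos_of_nonneg (h.geod _ (Or.inr rfl)) (Real.exp_pos _).le)
    · rintro rfl
      rw [hbl, hbl, ← mul_sub]
      refine mul_nonneg ?_ (sub_nonneg.2 hexp)
      exact mul_nonneg_of_nonpos_of_nonpos (by norm_num)
        (div_nonpos_of_nonpos_of_nonneg (h.geod _ (Or.inl rfl)) (Real.exp_pos _).le)
    · exact (hasDerivWithinAt_pd_one hP hy).sub (hasDerivWithinAt_pd_one hP hy)
  have hR1 := h.scalarCurv_eq hs0.le (x + α) hy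
  have hR2 := h.scalarCurv_eq hs0.le x hy
  rw [← hw] at hR1 hR2
  set d := w ![x + α, y] - w ![x, y] with hd
  set R₂ := scalarCurv ρ (g s) ![x, y] with hR₂
  obtain ⟨hd0, hd1⟩ := one_sub_exp_neg_bounds hpos
  have hfy := h.f_pos y hy
  have hsplit : (Real.exp (w ![x + α, y]))⁻¹ = Real.exp (-d) * (Real.exp (w ![x, y]))⁻¹ := by
    rw [← Real.exp_neg, ← Real.exp_neg, ← Real.exp_add]
    congr 1
    rw [hd]
    ring
  have hinv : 0 < (Real.exp (w ![x + α, y]))⁻¹ := inv_pos.2 (Real.exp_pos _)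
  -- The Laplacian of `w` is no larger at the rotated point, and the conformal factors there differ
  -- by `exp d`. What is left, `R₂ (1 - exp (-d))`, is at most `B d`.
  have hR1' : -scalarCurv ρ (g s) ![x + α, y] ≤ -(Real.exp (-d) * R₂) := by
    have e2 : -(Real.exp (-d) * R₂) = (Real.exp (w ![x + α, y]))⁻¹ *
        (pd ρ 0 (pd ρ 0 w) ![x, y]
          + f y * pd ρ 1 (fun q => f (q 1) * pd ρ 1 w q) ![x, y]) := by
      rw [hR2, hsplit]
      ring
    rw [e2, hR1, neg_mul, neg_neg]
    refine mul_le_mul_of_nonneg_left ?_ hinv.le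
    have := mul_nonpos_of_nonneg_of_nonpos hfy.le hlap1
    linarith
  have hR2B : R₂ ≤ B := (le_abs_self _).trans hB
  have hB0 : 0 ≤ B := (abs_nonneg _).trans hB
  calc _ ≤ R₂ * (1 - Real.exp (-d)) := by linarith
    _ ≤ B * (1 - Real.exp (-d)) := mul_le_mul_of_nonneg_right hR2B hd0
    _ ≤ B * d := mul_le_mul_of_nonneg_left hd1 hB0

/-- Rotations do not increase the conformal factor, by the maximum principle for the difference of
two solutions. -/
theorem logFactor_shift_le (h : RotFlow ρ f g) (α : ℝ) {t : ℝ} (ht : 0 ≤ t) (θ : ℝ) {r : ℝ}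
    (hr : r ∈ Icc (-ρ) ρ) : logFactor g t ![θ + α, r] ≤ logFactor g t ![θ, r] := by
  set D : ℝ × (ℝ × ℝ) → ℝ := fun q =>
    logFactor g q.1 ![q.2.1 + α, q.2.2] - logFactor g q.1 ![q.2.1, q.2.2] with hD
  -- One closed period: compact, while periodicity makes a maximum over `K` a maximum over the whole
  -- strip.
  set K : Set (ℝ × ℝ) := Icc 0 (2 * Real.pi) ×ˢ Icc (-ρ) ρ with hK
  have hKc : IsCompact K := isCompact_Icc.prod isCompact_Icc
  have hv : ∀ β : ℝ, Continuous fun q : ℝ × (ℝ × ℝ) => (![q.2.1 + β, q.2.2] : Pt) := fun β =>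
    (contDiff_vec (x := fun q : ℝ × (ℝ × ℝ) => q.2.1 + β) (y := fun q => q.2.2)
      (by fun_prop) (by fun_prop)).continuous
  have hv0 : Continuous fun q : ℝ × (ℝ × ℝ) => (![q.2.1, q.2.2] : Pt) := by simpa using hv 0
  have hper : ∀ s, 0 ≤ s → ∀ y ∈ Icc (-ρ) ρ,
      Function.Periodic (fun x => D (s, (x, y))) (2 * Real.pi) := by
    intro s hs y hy x
    simp only [hD]
    rw [h.flow.logFactor_periodic hs x hy, add_right_comm, h.flow.logFactor_periodic hs _ hy]
  have hext : ∀ s, 0 ≤ s → ∀ y ∈ Icc (-ρ) ρ, ∀ x, ∃ x', (x', y) ∈ K ∧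
      D (s, (x, y)) = D (s, (x', y)) := by
    intro s hs y hy x
    obtain ⟨x', hx', he⟩ := (hper s hs y hy).exists_mem_Ico₀ Real.two_pi_pos x
    exact ⟨x', ⟨Ico_subset_Icc_self hx', hy⟩, he⟩
  have hmapsK : ∀ q ∈ Icc 0 t ×ˢ K, q.1 ∈ Ici (0 : ℝ) := fun q hq => hq.1.1
  obtain ⟨B, hB⟩ := (isCompact_Icc.prod hKc).exists_bound_of_continuousOn
    (f := fun q : ℝ × (ℝ × ℝ) => scalarCurv ρ (g q.1) ![q.2.1, q.2.2]) (s := Icc 0 t ×ˢ K)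
    (continuousOn_comp_pair (fun s => scalarCurv ρ (g s)) h.flow.continuous_scalarCurv
      continuous_fst hv0 fun q hq => ⟨hmapsK q hq, mem_band.2 hq.2.2⟩)
  have hDc : ContinuousOn D (Icc 0 t ×ˢ K) :=
    (continuousOn_comp_pair (logFactor g) h.flow.logFactor_continuous continuous_fst (hv α)
      fun q hq => ⟨hmapsK q hq, mem_band.2 hq.2.2⟩).sub
    (continuousOn_comp_pair (logFactor g) h.flow.logFactor_continuous continuous_fst hv0
      fun q hq => ⟨hmapsK q hq, mem_band.2 hq.2.2⟩)
  have key := nonpos_of_deriv_le_at_max hKc (t₀ := 0) (T := t) (C := B) hDc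
    (fun x hx => by
      simp only [hD]
      rw [h.logFactor_zero (mem_band.2 hx.2), h.logFactor_zero (mem_band.2 hx.2)]
      simp)
    (by
      rintro s hs ⟨x, y⟩ ⟨hx, hy⟩ hmax hpos
      simp only at hx hy
      have hs0 : 0 < s := hs.1
      have hmax' : ∀ x', ∀ y' ∈ Icc (-ρ) ρ, D (s, (x', y')) ≤ D (s, (x, y)) := by
        intro x' y' hy'
        obtain ⟨x'', hx'', he⟩ := hext s hs0.le y' hy' x'
        rw [he]
        exact hmax _ hx''
      -- The average curvature is the same at both points and cancels in the difference.
      refine ⟨_, (h.flow.hasDerivAt_logFactor hs0 (p := ![x + α, y]) (mem_band.2 hy)).sub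
        (h.flow.hasDerivAt_logFactor hs0 (p := ![x, y]) (mem_band.2 hy)), ?_⟩
      have := h.scalarCurv_sub_le_of_max α hs0 rfl hy hmax' hpos
        (hB (s, (x, y)) ⟨⟨hs0.le, hs.2⟩, hx, hy⟩)
      simp only [hD]
      linarith)
  obtain ⟨x', hx', he⟩ := hext t ht r hr θ
  have := key t ⟨ht, le_rfl⟩ _ hx'
  rw [← he] at this
  exact sub_nonpos.1 this

/-- The flow stays rotationally symmetric. -/
theorem logFactor_indep (h : RotFlow ρ f g) {t : ℝ} (ht : 0 ≤ t) (θ : ℝ) {r : ℝ}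
    (hr : r ∈ Icc (-ρ) ρ) : logFactor g t ![θ, r] = logFactor g t ![0, r] := by
  apply le_antisymm
  · simpa using h.logFactor_shift_le θ ht 0 hr
  · simpa using h.logFactor_shift_le (-θ) ht θ hr

theorem scalarCurv_eq_radial (h : RotFlow ρ f g) {t : ℝ} (ht : 0 ≤ t) (θ : ℝ) {r : ℝ}
    (hr : r ∈ Icc (-ρ) ρ) : scalarCurv ρ (g t) ![θ, r]
      = -(f r / Real.exp (logFactor g t ![0, r]))
        * pd ρ 1 (fun q => f (q 1) * pd ρ 1 (logFactor g t) q) ![0, r] := by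
  have hI := h.isoData ht
  have hind := fun θ r (hr : r ∈ Icc (-ρ) ρ) => h.logFactor_indep ht θ hr
  have h0 : EqOn (pd ρ 0 (logFactor g t)) (fun _ => 0) (band ρ) := by
    intro q hq
    rw [← eq_vec q]
    refine pd_zero_eq hI.w_smooth hq ((hasDerivAt_const (q 0)
      (logFactor g t ![0, q 1])).congr_of_eventuallyEq ?_)
    exact Eventually.of_forall fun s => hind s (q 1) hq
  have h00 : pd ρ 0 (pd ρ 0 (logFactor g t)) ![θ, r] = 0 := by
    rw [pd_congr h0 (mem_band.2 hr), pd]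
    simp
  have hflux := pd_one_eq_of_indep h.hρ hI.flux_smooth (fun θ r hr => by
    change f r * _ = f r * _
    rw [pd_one_eq_of_indep h.hρ hI.w_smooth hind θ hr]) θ hr
  rw [h.scalarCurv_eq ht θ hr, h00, hflux, hind θ r hr]
  ring

theorem scalarCurv_indep (h : RotFlow ρ f g) {t : ℝ} (ht : 0 ≤ t) (θ : ℝ) {r : ℝ}
    (hr : r ∈ Icc (-ρ) ρ) : scalarCurv ρ (g t) ![θ, r] = scalarCurv ρ (g t) ![0, r] := by
  rw [h.scalarCurv_eq_radial ht θ hr, h.scalarCurv_eq_radial ht 0 hr]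

theorem integralM_eq (h : RotFlow ρ f g) {t : ℝ} (ht : 0 ≤ t) {u : Pt → ℝ}
    (hu : ∀ θ, ∀ r ∈ Icc (-ρ) ρ, u ![θ, r] = u ![0, r]) : integralM ρ (g t) u
      = 2 * Real.pi * ∫ x in (-ρ)..ρ, Real.exp (logFactor g t ![0, x]) / f x * u ![0, x] := by
  have hle : -ρ ≤ ρ := by linarith [h.hρ]
  have h1 : ∀ θ, ∫ r in (-ρ)..ρ, u ![θ, r] * √((g t ![θ, r]).det)
      = ∫ x in (-ρ)..ρ, Real.exp (logFactor g t ![0, x]) / f x * u ![0, x] := by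
    intro θ
    refine intervalIntegral.integral_congr fun r hr => ?_
    rw [uIcc_of_le hle] at hr
    have hfr := h.f_pos r hr
    have hdet : (g t ![θ, r]).det = (Real.exp (logFactor g t ![0, r]) / f r) ^ 2 := by
      rw [h.eqOn_isoMetric ht (mem_band.2 hr), isoMetric, Matrix.det_fin_two_of,
        h.logFactor_indep ht θ hr]
      simp only [Matrix.cons_val_one, Matrix.cons_val_fin_one]
      field_simp
      ring
    rw [hdet, Real.sqrt_sq (by positivity), hu θ r hr, mul_comm]
  simp only [integralM, h1]
  rw [intervalIntegral.integral_const, sub_zero, smul_eq_mul]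

/-- The flow in terms of its radial profile. -/
theorem cylFlow (h : RotFlow ρ f g) (h_area : area ρ (rotMetric f) = 1)
    (h_curv : ∀ p ∈ band ρ, 0 ≤ scalarCurv ρ (rotMetric f) p) :
    CylFlow ρ (-geodCurv ρ (rotMetric f) ![0, ρ]) (-geodCurv ρ (rotMetric f) ![0, -ρ]) f
      (fun q => logFactor g q.1 ![0, q.2]) (fun q => scalarCurv ρ (g q.1) ![0, q.2])
      (fun t => avgCurv ρ (g t)) := by
  have hle : -ρ ≤ ρ := by linarith [h.hρ]
  have hv : ContDiff ℝ ∞ fun q : ℝ × ℝ => (q.1, (![0, q.2] : Pt)) :=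
    contDiff_fst.prodMk (contDiff_vec contDiff_const contDiff_snd)
  have hv2 : Continuous fun q : ℝ × ℝ => (![0, q.2] : Pt) := hv.continuous.snd
  have hW : ContDiffOn ℝ ∞ (fun q : ℝ × ℝ => logFactor g q.1 ![0, q.2]) (strip ρ) :=
    h.flow.logFactor_smooth_joint.comp hv.contDiffOn fun q hq => ⟨hq.1, mem_band.2 hq.2⟩
  have hdx : ∀ t, 0 < t → ∀ x ∈ Icc (-ρ) ρ, dx ρ (fun q => logFactor g q.1 ![0, q.2]) (t, x)
      = pd ρ 1 (logFactor g t) ![0, x] := fun t ht x hx =>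
    CylFlow.unique_dx h.hρ hW ht hx (hasDerivWithinAt_pd_one (h.isoData ht.le).w_smooth hx)
  have hbd : ∀ x t, Real.exp ((logFactor g t ![0, x]
      - ∫ s in (0 : ℝ)..t, avgCurv ρ (g s)) / 2) = Real.exp (logFactor g t ![0, x] / 2)
      / Real.exp ((∫ s in (0 : ℝ)..t, avgCurv ρ (g s)) / 2) := fun x t => by
    rw [← Real.exp_sub, sub_div]
  have hflux : ContDiffOn ℝ ∞
      (fun p : ℝ × ℝ => f p.2 * dx ρ (fun q => logFactor g q.1 ![0, q.2]) p) (strip ρ) :=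
    (h.f_smooth.comp contDiff_snd.contDiffOn fun _ hq => hq.2).mul
      (contDiffOn_dirDeriv (uniqueDiffOn_strip h.hρ) (0, 1) hW)
  refine ⟨h.hρ, neg_nonneg.2 (h.geod _ (Or.inr rfl)), neg_nonneg.2 (h.geod _ (Or.inl rfl)),
    h.f_smooth, h.f_pos, hW, ?_, ?_, ?_, ?_, ?_, ?_, ?_, ?_, ?_⟩
  · exact continuousOn_comp_pair (logFactor g) h.flow.logFactor_continuous continuous_fst hv2
      fun q hq => ⟨hq.1, mem_band.2 hq.2⟩
  · exact continuousOn_comp_pair (fun s => scalarCurv ρ (g s)) h.flow.continuous_scalarCurv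
      continuous_fst hv2 fun q hq => ⟨hq.1, mem_band.2 hq.2⟩
  · rintro ⟨t, x⟩ ⟨ht, hx⟩
    simp only at ht hx ⊢
    rw [mem_Ioi] at ht
    rw [h.scalarCurv_eq_radial ht.le 0 hx]
    congr 1
    symm
    refine CylFlow.unique_dx h.hρ hflux ht hx ?_
    · refine (hasDerivWithinAt_pd_one (h.isoData ht.le).flux_smooth hx).congr (fun y hy => ?_) ?_
      · simp only [hdx t ht y hy]
        rfl
      · simp only [hdx t ht x hx]
        rfl
  · exact fun t ht x hx => h.flow.hasDerivAt_logFactor ht (mem_band.2 hx)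
  · exact fun t ht => h.integralM_eq ht fun θ r hr => h.scalarCurv_indep ht θ hr
  · rw [← h_area, area, show integralM ρ (rotMetric f) (fun _ => 1) = integralM ρ (g 0) fun _ => 1 by
      refine intervalIntegral.integral_congr fun θ _ => ?_
      refine intervalIntegral.integral_congr fun r hr => ?_
      rw [uIcc_of_le hle] at hr
      simp only
      rw [h.flow.initial _ (mem_band.2 hr)], h.integralM_eq le_rfl fun _ _ _ => rfl]
    simp
  · intro x hx
    -- The fields `g 0` and `rotMetric f` are only known to agree on the band; both curvatures are
    -- therefore compared with the same conformal formula.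
    have := h_curv ![0, x] (mem_band.2 hx)
    rwa [(h.isoData le_rfl).scalarCurv_eq h.rotMetric_eqOn_isoMetric hx,
      ← h.scalarCurv_eq le_rfl 0 hx] at this
  · intro t ht
    rw [hdx t ht ρ h.right_mem, h.bdry_right ht, hbd]
    ring
  · intro t ht
    rw [hdx t ht (-ρ) h.left_mem, h.bdry_left ht, hbd]
    ring

end RotFlow
end Cylinder

theorem mainTheorem9 (ρ : ℝ) (hρ : 0 < ρ) (f : ℝ → ℝ)
    (hf_smooth : ContDiffOn ℝ ∞ f (Icc (-ρ) ρ))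
    (hf_pos : ∀ r ∈ Icc (-ρ) ρ, 0 < f r)
    (hf_symm : ∀ r ∈ Icc (-ρ) ρ, f (-r) = f r)
    (h_area : Cylinder.area ρ (Cylinder.rotMetric f) = 1)
    (h_curv : ∀ p ∈ Cylinder.band ρ, 0 ≤ Cylinder.scalarCurv ρ (Cylinder.rotMetric f) p)
    (h_geod : ∀ p ∈ Cylinder.bdry ρ, Cylinder.geodCurv ρ (Cylinder.rotMetric f) p ≤ 0)
    (h_decr : Cylinder.DecreasingFromMiddle ρ (Cylinder.scalarCurv ρ (Cylinder.rotMetric f)))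
    (g : ℝ → Cylinder.Field2)
    (hg : Cylinder.IsNormalisedRicciFlow ρ (Cylinder.rotMetric f) g) :
    TendstoUniformlyOn (fun (t : ℝ) (p : Cylinder.Pt) => Cylinder.scalarCurv ρ (g t) p)
      (fun _ => 0) atTop (Cylinder.band ρ) := by
  have h : Cylinder.RotFlow ρ f g := ⟨hρ, hf_smooth, hf_pos, h_geod, hg⟩
  have hC := h.cylFlow h_area h_curv
  rw [Metric.tendstoUniformlyOn_iff]
  intro ε hε
  obtain ⟨T, hT⟩ := hC.exists_R_le (half_pos hε)
  filter_upwards [eventually_ge_atTop T, eventually_ge_atTop 0] with t ht ht0 p hp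
  rw [← Cylinder.eq_vec p, h.scalarCurv_indep ht0 _ hp, dist_comm, Real.dist_0_eq_abs,
    abs_of_nonneg (hC.R_nonneg ht0 hp)]
  exact (hT t ht (p 1) hp).trans_lt (half_lt_self hε)
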